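/- **Lemma.** Let $d\ge 1$, let $\Omega\subset\mathbb R^d$ be a bounded open set (for instance a bounded connected Lipschitz domain in $\mathbb R^2$ or $\mathbb R^3$), let $0\le\alpha\le 1$, and let $K:\Omega\to\mathbb R^{d\times d}$ be a measurable, symmetric, bounded and uniformly positive definite coefficient. Write $(\cdot,\cdot)$ and $\|\cdot\|$ for the $L^2(\Omega)$ inner product and norm. Consider the mixed generalized Poisson problem $$K^{-1}u+\nabla p=0,\qquad \nabla\cdot u+\alpha p=f\quad\text{in }\Omega,\qquad p=0\ \text{on }\partial\Omega .$$ Let $V=K^{-1/2}\mathbf L^2(\Omega)\cap \mathbf H(\mathrm{div},\Omega)$ and $Q_b=K^{1/2}H^1_0(\Omega)+L^2(\Omega)$, with $$\|u\|_V^2=\|K^{-1/2}u\|^2+\|\nabla\cdot u\|^2,\qquad \|p\|_b^2=\inf_{r\in H^1_0(\Omega)}\bigl(\|p-r\|^2+\|K^{1/2}\nabla r\|^2\bigr),$$ let $Q=L^2(\Omega)$ (which has the same elements as $Q_b$) with $\|p\|_Q^2=\|p\|_b^2+\|p\|^2$, and put $$a(u,v)=(K^{-1}u,v),\qquad b(u,q)=(\nabla\cdot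 u,q),\qquad c(p,q)=(p,q),\qquad |||(v,q)|||^2=\|v\|_V^2+\|q\|_b^2+\alpha\|q\|^2 .$$ There are constants $\beta,C>0$, independent of $K$ and $\alpha$ (and of $\Omega$ and $d$), such that the following hold. 1. $\|\cdot\|_V$, $\|\cdot\|_b$ and $\|\cdot\|_Q$ are Hilbert space norms. The forms $a,b,c$ are bilinear, $a$ and $c$ are symmetric and positive semidefinite, $|a(u,v)|\le C\|u\|_V\|v\|_V$ and $|b(u,q)|\le C\|u\|_V\|q\|_b$. 2. (Brezzi conditions) $a(v,v)\ge\beta\|v\|_V^2$ for every $v\in V$ with $b(v,q)=0$ for all $q\in Q_b$, and $\sup_{v\in V} b(v,p)/\|v\|_V\ge\beta\|p\|_b$ for every $p\in Q_b$. 3. (Braess condition) $\displaystyle\sup_{(v,q)\in V\times Q}\frac{a(u,v)+b(u,q)}{|||(v,q)|||}\ge\beta\|u\|_V$ for every $u\in V$. 4. (Stability) For all linear functionals $F$ on $V$ and $G$ on $Q$ and every $M\ge 0$ with $|F(v)+G(q)|\le M\,|||(v,q)|||$ for all $(v,q)\in V\times Q$, there is exactly one $(u,p)\in V\times Q$ with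 $$a(u,v)-b(v,p)=F(v)\ \ \forall v\in V,\qquad b(u,q)+\alpha\,c(p,q)=G(q)\ \ \forall q\in Q,$$ and $|||(u,p)|||\le C M$. 5. For every $f\in L^2(\Omega)$ this problem has exactly one solution with $F=0$ and $G(q)=(f,q)$. Moreover, statements 2, 3 and 4 remain true, with the same $\beta$ and $C$, if $H^1_0(\Omega)$ is replaced by $H^1(\Omega)$ in the definition of $\|\cdot\|_b$ (which is then only a seminorm). -/

import Mathlib

open MeasureTheory Filter Topology
open scoped ContDiff Matrix

noncomputable section

namespace MixedPoisson

/-! ### Perturbed saddle-point problems in the abstract -/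

section Abstract

variable {V Q : Type*} [AddCommGroup V] [Module ℝ V] [AddCommGroup Q] [Module ℝ Q]

/-- `N` is a norm on `X`, it comes from an inner product, and `X` is complete for it. -/
structure IsHilbertNorm {X : Type*} [AddCommGroup X] [Module ℝ X] (N : X → ℝ) : Prop where
  nonneg : ∀ x, 0 ≤ N x
  definite : ∀ x, N x = 0 → x = 0
  inner_product : ∃ B : X →ₗ[ℝ] X →ₗ[ℝ] ℝ, (∀ x y, B x y = B y x) ∧ ∀ x, N x ^ 2 = B x x
  complete : ∀ s : ℕ → X,
    (∀ ε : ℝ, 0 < ε → ∃ n₀, ∀ m ≥ n₀, ∀ n ≥ n₀, N (s m - s n) < ε) →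
      ∃ x, Tendsto (fun n => N (s n - x)) atTop (𝓝 0)

/-- A function of two vector arguments is linear in each of them. -/
def IsBilinear {X Y : Type*} [AddCommGroup X] [Module ℝ X] [AddCommGroup Y] [Module ℝ Y]
    (f : X → Y → ℝ) : Prop :=
  (∀ x, IsLinearMap ℝ (f x)) ∧ ∀ y, IsLinearMap ℝ fun x => f x y

/-- `sup_x num x / den x ≥ s`: every nonnegative `M` with `num ≤ M * den` is at least `s`. -/
def SupQuotientGE {X : Type*} (num den : X → ℝ) (s : ℝ) : Prop :=
  ∀ M : ℝ, 0 ≤ M → (∀ x, num x ≤ M * den x) → s ≤ M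

/-- The data of a perturbed saddle-point problem
`A u - Bᵗ p = F`, `B u + t² C p = G`: the norms `‖·‖_V` and `‖·‖_b`, the forms `a`, `b`, `c`
and the scaling parameter `t`. -/
structure SaddlePoint (V Q : Type*) where
  normV : V → ℝ
  normB : Q → ℝ
  a : V → V → ℝ
  b : V → Q → ℝ
  c : Q → Q → ℝ
  t : ℝ

namespace SaddlePoint

/-- The norm `(‖p‖_b² + c(p, p))^{1/2}` of `Q`. -/
def normQ (P : SaddlePoint V Q) (p : Q) : ℝ :=
  √(P.normB p ^ 2 + P.c p p)

/-- The energy norm `(‖v‖_V² + ‖q‖_b² + t² c(q, q))^{1/2}`. -/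
def energy (P : SaddlePoint V Q) (v : V) (q : Q) : ℝ :=
  √(P.normV v ^ 2 + P.normB q ^ 2 + P.t ^ 2 * P.c q q)

/-- The setting of the theory: Hilbert norms, `a` and `b` continuous with constant `C`,
`a` and `c` symmetric and positive semidefinite, `0 ≤ t ≤ 1`. -/
structure Setting (P : SaddlePoint V Q) (C : ℝ) : Prop where
  hilbert_V : IsHilbertNorm P.normV
  hilbert_b : IsHilbertNorm P.normB
  hilbert_Q : IsHilbertNorm P.normQ
  bilinear_a : IsBilinear P.a
  bilinear_b : IsBilinear P.b
  bilinear_c : IsBilinear P.c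
  continuous_a : ∀ u v, |P.a u v| ≤ C * P.normV u * P.normV v
  continuous_b : ∀ u q, |P.b u q| ≤ C * P.normV u * P.normB q
  symm_a : ∀ u v, P.a u v = P.a v u
  nonneg_a : ∀ v, 0 ≤ P.a v v
  symm_c : ∀ p q, P.c p q = P.c q p
  nonneg_c : ∀ q, 0 ≤ P.c q q
  t_nonneg : 0 ≤ P.t
  t_le_one : P.t ≤ 1

/-- The two Brezzi conditions: `a` is coercive on `Ker B`, and `b` satisfies the inf-sup
condition in the norms `‖·‖_V` and `‖·‖_b`. -/
structure Brezzi (P : SaddlePoint V Q) (β : ℝ) : Prop where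
  coercive : ∀ v, (∀ q, P.b v q = 0) → β * P.normV v ^ 2 ≤ P.a v v
  inf_sup : ∀ p, SupQuotientGE (fun v => P.b v p) P.normV (β * P.normB p)

/-- The Braess condition. -/
def Braess (P : SaddlePoint V Q) (β : ℝ) : Prop :=
  ∀ u, SupQuotientGE (fun x : V × Q => P.a u x.1 + P.b u x.2)
    (fun x : V × Q => P.energy x.1 x.2) (β * P.normV u)

/-- `x = (u, p)` solves `A u - Bᵗ p = F`, `B u + t² C p = G`. -/
def Solves (P : SaddlePoint V Q) (F : V → ℝ) (G : Q → ℝ) (x : V × Q) : Prop :=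
  (∀ v, P.a x.1 v - P.b v x.2 = F v) ∧ ∀ q, P.b x.1 q + P.t ^ 2 * P.c x.2 q = G q

/-- Stability in the energy norm: for all right-hand sides `(F, G)` whose norm dual to the energy
norm is finite, there is exactly one solution, and its energy norm is at most `C` times that
dual norm. -/
def Stable (P : SaddlePoint V Q) (C : ℝ) : Prop :=
  ∀ (F : V →ₗ[ℝ] ℝ) (G : Q →ₗ[ℝ] ℝ) (M : ℝ), 0 ≤ M →
    (∀ v q, |F v + G q| ≤ M * P.energy v q) →
      ∃ x : V × Q, P.Solves F G x ∧ (∀ y, P.Solves F G y → y = x) ∧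
        P.energy x.1 x.2 ≤ C * M

end SaddlePoint

end Abstract

/-! ### Function spaces on a domain of `ℝ^d` -/

/-- `L²(Ω)`. -/
abbrev L2 {d : ℕ} (Ω : Set (EuclideanSpace ℝ (Fin d))) :=
  Lp ℝ 2 (volume.restrict Ω)

/-- The vector fields with components in `L²(Ω)`. -/
abbrev L2Vec {d : ℕ} (Ω : Set (EuclideanSpace ℝ (Fin d))) :=
  Lp (EuclideanSpace ℝ (Fin d)) 2 (volume.restrict Ω)

variable {d : ℕ}

/-- `φ ∈ C_c^∞(Ω)`. -/
structure IsTestFunction (Ω : Set (EuclideanSpace ℝ (Fin d)))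
    (φ : EuclideanSpace ℝ (Fin d) → ℝ) : Prop where
  smooth : ContDiff ℝ ∞ φ
  compact : HasCompactSupport φ
  support_subset : tsupport φ ⊆ Ω

/-- The pairs `(φ, ∇φ)` with `φ ∈ C_c^∞(Ω)`, as elements of `L²(Ω) × L²(Ω)^d`. -/
def testGraph (Ω : Set (EuclideanSpace ℝ (Fin d))) : Set (L2 Ω × L2Vec Ω) :=
  {z | ∃ φ, IsTestFunction Ω φ ∧ z.1 =ᵐ[volume.restrict Ω] φ ∧
    z.2 =ᵐ[volume.restrict Ω] fun x => gradient φ x}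

/-- Every test function gives an element of `testGraph Ω`. -/
theorem exists_mem_testGraph {Ω : Set (EuclideanSpace ℝ (Fin d))}
    {φ : EuclideanSpace ℝ (Fin d) → ℝ} (hφ : IsTestFunction Ω φ) :
    ∃ z ∈ testGraph Ω, z.1 =ᵐ[volume.restrict Ω] φ ∧
      z.2 =ᵐ[volume.restrict Ω] fun x => gradient φ x := by
  have h1 : MemLp φ 2 (volume.restrict Ω) :=
    (hφ.smooth.continuous.memLp_of_hasCompactSupport hφ.compact)
  have hc : Continuous fun x => gradient φ x :=
    (InnerProductSpace.toDual ℝ (EuclideanSpace ℝ (Fin d))).symm.continuous.comp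
      (hφ.smooth.continuous_fderiv (by simp))
  have hs : HasCompactSupport fun x => gradient φ x :=
    (hφ.compact.fderiv ℝ).comp_left
      (g := (InnerProductSpace.toDual ℝ (EuclideanSpace ℝ (Fin d))).symm) (by simp)
  have h2 : MemLp (fun x => gradient φ x) 2 (volume.restrict Ω) :=
    hc.memLp_of_hasCompactSupport hs
  exact ⟨(h1.toLp _, h2.toLp _), ⟨φ, hφ, h1.coeFn_toLp, h2.coeFn_toLp⟩,
    h1.coeFn_toLp, h2.coeFn_toLp⟩

/-- The graph `{(r, ∇r) : r ∈ H¹(Ω)}` of the weak gradient: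
`∫ r ∂ᵢφ = - ∫ (∇r)ᵢ φ` for all test functions `φ` and all `i`. -/
def H1Graph (Ω : Set (EuclideanSpace ℝ (Fin d))) : Set (L2 Ω × L2Vec Ω) :=
  {w | ∀ z ∈ testGraph Ω, ∀ i : Fin d,
    ∫ x in Ω, w.1 x * z.2 x i = - ∫ x in Ω, w.2 x i * z.1 x}

/-- The graph `{(r, ∇r) : r ∈ H¹₀(Ω)}`: the closure of `C_c^∞(Ω)` in the norm of `H¹(Ω)`. -/
def H10Graph (Ω : Set (EuclideanSpace ℝ (Fin d))) : Set (L2 Ω × L2Vec Ω) :=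
  closure (testGraph Ω)

/-- `g = ∇ · u` weakly: `∫ u · ∇φ = - ∫ g φ` for all test functions `φ`. -/
def HasWeakDiv (Ω : Set (EuclideanSpace ℝ (Fin d))) (u : L2Vec Ω) (g : L2 Ω) : Prop :=
  ∀ z ∈ testGraph Ω, inner ℝ u z.2 = - inner ℝ g z.1

/-- `H(div, Ω)`. -/
def HDiv (Ω : Set (EuclideanSpace ℝ (Fin d))) : Submodule ℝ (L2Vec Ω) where
  carrier := {u | ∃ g, HasWeakDiv Ω u g}
  zero_mem' := ⟨0, fun z _ => by simp⟩
  add_mem' := by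
    rintro u v ⟨g, hg⟩ ⟨h, hh⟩
    refine ⟨g + h, fun z hz => ?_⟩
    rw [inner_add_left, inner_add_left, hg z hz, hh z hz]
    ring
  smul_mem' := by
    rintro k u ⟨g, hg⟩
    refine ⟨k • g, fun z hz => ?_⟩
    rw [real_inner_smul_left, real_inner_smul_left, hg z hz]
    ring

/-- The weak divergence of a field in `H(div, Ω)`. -/
def weakDiv {Ω : Set (EuclideanSpace ℝ (Fin d))} (u : HDiv Ω) : L2 Ω :=
  Classical.choose u.2

/-- The weighted inner product `∫_Ω (W u) · v`, for a field `W` of matrices. -/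
def weightedInner {Ω : Set (EuclideanSpace ℝ (Fin d))}
    (W : EuclideanSpace ℝ (Fin d) → Matrix (Fin d) (Fin d) ℝ) (u v : L2Vec Ω) : ℝ :=
  ∫ x in Ω, (W x *ᵥ (u x).ofLp) ⬝ᵥ (v x).ofLp

/-- If `S` is a symmetric square root of `W`, then `∫ (W u) · u` is `∫ |S u|²`; so the weighted
inner products below do give the squares of `‖K^{-1/2} u‖` and `‖K^{1/2} ∇r‖`. -/
theorem weightedInner_self_eq {Ω : Set (EuclideanSpace ℝ (Fin d))}
    (W S : EuclideanSpace ℝ (Fin d) → Matrix (Fin d) (Fin d) ℝ)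
    (hS : ∀ x, (S x).IsSymm) (hW : ∀ x, S x * S x = W x) (u : L2Vec Ω) :
    weightedInner W u u = ∫ x in Ω, ‖WithLp.toLp 2 (S x *ᵥ (u x).ofLp)‖ ^ 2 := by
  unfold weightedInner
  congr 1
  ext x
  rw [← hW x, ← Matrix.mulVec_mulVec, EuclideanSpace.real_norm_sq_eq, dotProduct_comm,
    Matrix.dotProduct_mulVec, ← Matrix.mulVec_transpose, (hS x).eq]
  simp [dotProduct, sq]

/-- `K` is an admissible coefficient on `Ω`: measurable, symmetric, bounded, and uniformly
positive definite (the bounds `k₀`, `k₁` may depend on `K`). -/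
structure IsCoefficient (Ω : Set (EuclideanSpace ℝ (Fin d)))
    (K : EuclideanSpace ℝ (Fin d) → Matrix (Fin d) (Fin d) ℝ) : Prop where
  measurable : ∀ i j, Measurable fun x => K x i j
  symm : ∀ x ∈ Ω, (K x).IsSymm
  elliptic : ∃ k₀ k₁ : ℝ, 0 < k₀ ∧ ∀ x ∈ Ω, ∀ ξ : Fin d → ℝ,
    k₀ * (ξ ⬝ᵥ ξ) ≤ (K x *ᵥ ξ) ⬝ᵥ ξ ∧ (K x *ᵥ ξ) ⬝ᵥ ξ ≤ k₁ * (ξ ⬝ᵥ ξ)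

/-! ### The mixed generalized Poisson problem -/

/-- `‖u‖_V = (‖K^{-1/2} u‖² + ‖∇ · u‖²)^{1/2}` on `V = K^{-1/2} L² ∩ H(div)`. Since `K` is bounded
and uniformly positive definite, `V` has the same elements as `H(div, Ω)`. -/
def normV {Ω : Set (EuclideanSpace ℝ (Fin d))}
    (K : EuclideanSpace ℝ (Fin d) → Matrix (Fin d) (Fin d) ℝ) (u : HDiv Ω) : ℝ :=
  √(weightedInner (fun x => (K x)⁻¹) (u : L2Vec Ω) u + ‖weakDiv u‖ ^ 2)

/-- `‖p‖_b = (inf_r ‖p - r‖² + ‖K^{1/2} ∇r‖²)^{1/2}`, the infimum over the pairs `(r, ∇r)` in `R`,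
which is `H1Graph Ω` or `H10Graph Ω`. The sum space `K^{1/2} R + L²` has the same elements as
`L²(Ω)`. -/
def normB {Ω : Set (EuclideanSpace ℝ (Fin d))} (R : Set (L2 Ω × L2Vec Ω))
    (K : EuclideanSpace ℝ (Fin d) → Matrix (Fin d) (Fin d) ℝ) (p : L2 Ω) : ℝ :=
  √(⨅ w : R, (‖p - (w : L2 Ω × L2Vec Ω).1‖ ^ 2 +
    weightedInner K (w : L2 Ω × L2Vec Ω).2 (w : L2 Ω × L2Vec Ω).2))

/-- The weak form of `K⁻¹ u + ∇p = F`, `∇ · u + α p = G`, `p = 0` on `∂Ω`, that is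
`a(u, v) = ∫ K⁻¹ u · v`, `b(u, q) = ∫ (∇ · u) q`, `c(p, q) = ∫ p q` and `t² = α`.
The fields `v ∈ V` carry no boundary condition, which makes `p = 0` a natural condition. -/
def problem (Ω : Set (EuclideanSpace ℝ (Fin d))) (R : Set (L2 Ω × L2Vec Ω))
    (K : EuclideanSpace ℝ (Fin d) → Matrix (Fin d) (Fin d) ℝ) (α : ℝ) :
    SaddlePoint (HDiv Ω) (L2 Ω) where
  normV := normV K
  normB := normB R K
  a u v := weightedInner (fun x => (K x)⁻¹) (u : L2Vec Ω) v
  b u q := inner ℝ (weakDiv u) q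
  c p q := inner ℝ p q
  t := √α

end MixedPoisson

end

/-!
The mixed problem is stable because three explicit test functions, with absolute constants,
control the energy norm.

For `p ∈ L²(Ω)` let `r ∈ H¹₀(Ω)` be the minimizer in the definition of `‖p‖_b`, that is the weak
solution of `r - ∇ · (K ∇r) = p` (`CoerciveOperator.exists_solution_operator`), which depends
linearly on `p`. Then `‖p‖_b² = ‖p - r‖² + ‖K^{1/2} ∇r‖² = (p - r, p)`, so that `‖·‖_b` comes from
an inner product, and the field `w = - K ∇r` has divergence `p - r`, hence
`‖w‖_V = ‖p‖_b` and `b(w, p) = ‖p‖_b²` (`WeightOperators.exists_lifting`). This is the inf-sup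
condition with constant `1`. Conversely `(∇ · u, q) = (∇ · u, q - r) - (u, ∇r)` for
`r ∈ H¹₀(Ω)`, which gives the continuity of `b`. By the Poincaré inequality on `H¹₀(Ω)`
(`exists_norm_fst_le`), `‖·‖_b` is equivalent to the norm of `L²(Ω)`. This yields the completeness
of `Q_b`, and its constant, which depends on `K` and `Ω`, enters no estimate.

Since `‖∇ · u‖_b ≤ ‖∇ · u‖`, the test function `(u, ∇ · u)` gives the Braess condition. For the
stability, test the system with `(u, p)`, with `(-w, 0)` and with `(0, ∇ · u)`. The sum is at
least half of the square of the energy norm of `(u, p)`, and the test function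
`(u - w, p + ∇ · u)` has at most three times the energy norm of `(u, p)`. The form of the system
is symmetric up to the sign of the
second component, so the same estimate holds for the adjoint system, and the Lax–Milgram theorem
gives existence (`SaddlePoint.Setting.stable`).

Replacing `H¹₀(Ω)` by `H¹(Ω)` makes `‖·‖_b` smaller and changes nothing else. The Brezzi and Braess
conditions and stability persist under such a change (`SaddlePoint.Stable.mono`).
-/

noncomputable section

namespace MixedPoisson

/-! ### Hilbert norms -/

section HilbertNorm

variable {X Y : Type*} [AddCommGroup X] [Module ℝ X] [AddCommGroup Y] [Module ℝ Y]

namespace IsHilbertNorm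

/-- A norm that comes from an inner product and is equivalent to a complete norm is a Hilbert
norm. -/
theorem of_equivalent {E : Type*} [NormedAddCommGroup E] [NormedSpace ℝ E] [CompleteSpace E]
    {N : E → ℝ} (h0 : ∀ x, 0 ≤ N x) (B : E →ₗ[ℝ] E →ₗ[ℝ] ℝ) (hsymm : ∀ x y, B x y = B y x)
    (hB : ∀ x, N x ^ 2 = B x x) {c C : ℝ} (hc : 0 < c) (hle : ∀ x, c * ‖x‖ ≤ N x)
    (hge : ∀ x, N x ≤ C * ‖x‖) : IsHilbertNorm N where
  nonneg := h0
  definite x hx := norm_le_zero_iff.1 (nonpos_of_mul_nonpos_right ((hle x).trans_eq hx) hc)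
  inner_product := ⟨B, hsymm, hB⟩
  complete s hs := by
    have hcau : CauchySeq s := by
      refine Metric.cauchySeq_iff.2 fun ε hε => ?_
      obtain ⟨n₀, h⟩ := hs (c * ε) (by positivity)
      refine ⟨n₀, fun m hm n hn => ?_⟩
      rw [dist_eq_norm]
      exact lt_of_mul_lt_mul_left ((hle _).trans_lt (h m hm n hn)) hc.le
    obtain ⟨x, hx⟩ := cauchySeq_tendsto_of_complete hcau
    have hx' := (tendsto_iff_norm_sub_tendsto_zero.1 hx).const_mul C
    rw [mul_zero] at hx'
    exact ⟨x, squeeze_zero (fun n => h0 _) (fun n => hge _) hx'⟩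

variable {N : X → ℝ}

theorem map_neg (hN : IsHilbertNorm N) (x : X) : N (-x) = N x := by
  obtain ⟨B, -, hB⟩ := hN.inner_product
  have h : N (-x) ^ 2 = N x ^ 2 := by rw [hB, hB]; simp
  exact (sq_eq_sq₀ (hN.nonneg _) (hN.nonneg _)).1 h

theorem add_sq_le (hN : IsHilbertNorm N) (x y : X) :
    N (x + y) ^ 2 ≤ 2 * N x ^ 2 + 2 * N y ^ 2 := by
  obtain ⟨B, hs, hB⟩ := hN.inner_product
  have h : 0 ≤ B (x - y) (x - y) := by rw [← hB]; positivity
  simp only [hB, map_add, map_sub, LinearMap.add_apply, LinearMap.sub_apply] at h ⊢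
  linarith [hs x y]

theorem sub_sq_le (hN : IsHilbertNorm N) (x y : X) :
    N (x - y) ^ 2 ≤ 2 * N x ^ 2 + 2 * N y ^ 2 := by
  simpa [sub_eq_add_neg, hN.map_neg] using hN.add_sq_le x (-y)

/-- The Lax–Milgram theorem for a vector space with a Hilbert norm. -/
theorem exists_eq_of_coercive (hN : IsHilbertNorm N) (B : X →ₗ[ℝ] X →ₗ[ℝ] ℝ) {c C : ℝ}
    (hc : 0 < c) (hB : ∀ x y, |B x y| ≤ C * N x * N y) (hco : ∀ x, c * N x ^ 2 ≤ B x x)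
    (l : X →ₗ[ℝ] ℝ) {M : ℝ} (hl : ∀ x, |l x| ≤ M * N x) : ∃ x, ∀ y, B x y = l y := by
  obtain ⟨J, hJs, hJ⟩ := hN.inner_product
  let core : InnerProductSpace.Core ℝ X :=
    { inner := fun x y => J x y
      conj_inner_symm := fun x y => hJs y x
      re_inner_nonneg := fun x => by
        change 0 ≤ J x x
        rw [← hJ]; positivity
      add_left := fun x y z => by simp
      smul_left := fun x y r => by simp
      definite := fun x hx => hN.definite x (by
        have : N x ^ 2 = 0 := (hJ x).trans hx
        simpa using this) }
  let _ : NormedAddCommGroup X := core.toNormedAddCommGroup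
  let _ : InnerProductSpace ℝ X := InnerProductSpace.ofCore core.toCore
  have hnorm : ∀ x : X, ‖x‖ = N x := fun x => by
    have : ‖x‖ ^ 2 = N x ^ 2 := by rw [← real_inner_self_eq_norm_sq, hJ]; rfl
    exact (sq_eq_sq₀ (norm_nonneg _) (hN.nonneg _)).1 this
  have : CompleteSpace X := by
    refine Metric.complete_of_cauchySeq_tendsto fun s hs => ?_
    obtain ⟨x, hx⟩ := hN.complete s fun ε hε => by
      obtain ⟨n₀, h⟩ := Metric.cauchySeq_iff.1 hs ε hε
      exact ⟨n₀, fun m hm n hn => by rw [← hnorm, ← dist_eq_norm]; exact h m hm n hn⟩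
    exact ⟨x, tendsto_iff_norm_sub_tendsto_zero.2 (by simpa only [hnorm] using hx)⟩
  let Bc : X →L[ℝ] X →L[ℝ] ℝ := B.mkContinuous₂ C fun x y => by
    rw [Real.norm_eq_abs, hnorm, hnorm]; exact hB x y
  let lc : X →L[ℝ] ℝ := l.mkContinuous M fun x => by
    rw [Real.norm_eq_abs, hnorm]; exact hl x
  have hcoer : IsCoercive Bc := ⟨c, hc, fun u => by
    have := hco u
    rw [← hnorm] at this
    change c * ‖u‖ * ‖u‖ ≤ B u u
    linarith [sq ‖u‖]⟩
  let f := (InnerProductSpace.toDual ℝ X).symm lc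
  refine ⟨hcoer.continuousLinearEquivOfBilin.symm f, fun y => ?_⟩
  have h := hcoer.continuousLinearEquivOfBilin_apply
    (hcoer.continuousLinearEquivOfBilin.symm f) y
  rw [ContinuousLinearEquiv.apply_symm_apply, InnerProductSpace.toDual_symm_apply] at h
  exact h.symm

/-- The solution operator of a coercive variational problem is linear. -/
theorem exists_linearMap_of_coercive (hN : IsHilbertNorm N) (B : X →ₗ[ℝ] X →ₗ[ℝ] ℝ) {c C : ℝ}
    (hc : 0 < c) (hB : ∀ x y, |B x y| ≤ C * N x * N y) (hco : ∀ x, c * N x ^ 2 ≤ B x x)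
    (l : Y →ₗ[ℝ] X →ₗ[ℝ] ℝ) (hl : ∀ y, ∃ M, ∀ x, |l y x| ≤ M * N x) :
    ∃ R : Y →ₗ[ℝ] X, ∀ y x, B (R y) x = l y x := by
  have hex : ∀ y, ∃ r, ∀ x, B r x = l y x := fun y => by
    obtain ⟨M, hM⟩ := hl y
    exact hN.exists_eq_of_coercive B hc hB hco (l y) hM
  choose R hR using hex
  have huniq : ∀ r s, (∀ x, B r x = B s x) → r = s := fun r s h => by
    have h1 := hco (r - s)
    have h2 : B (r - s) (r - s) = 0 := by
      rw [B.map_sub, LinearMap.sub_apply, h, sub_self]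
    have h3 : N (r - s) ^ 2 ≤ 0 := nonpos_of_mul_nonpos_right (h1.trans h2.le) hc
    exact sub_eq_zero.1 (hN.definite _ (pow_eq_zero_iff two_ne_zero |>.1
      (le_antisymm h3 (sq_nonneg _))))
  exact ⟨{ toFun := R
           map_add' := fun y z => huniq _ _ fun x => by simp [hR]
           map_smul' := fun k y => huniq _ _ fun x => by simp [hR] }, hR⟩

end IsHilbertNorm

end HilbertNorm

/-! ### Stability of perturbed saddle-point problems -/

namespace SaddlePoint

section

variable {V Q : Type*}

theorem sq_energy (P : SaddlePoint V Q) (hc : ∀ q, 0 ≤ P.c q q) (v : V) (q : Q) :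
    P.energy v q ^ 2 = P.normV v ^ 2 + P.normB q ^ 2 + P.t ^ 2 * P.c q q :=
  Real.sq_sqrt (add_nonneg (by positivity) (mul_nonneg (sq_nonneg _) (hc q)))

theorem energy_nonneg (P : SaddlePoint V Q) (v : V) (q : Q) : 0 ≤ P.energy v q :=
  Real.sqrt_nonneg _

theorem normV_le_energy (P : SaddlePoint V Q) (hc : ∀ q, 0 ≤ P.c q q) (v : V) (q : Q) :
    P.normV v ≤ P.energy v q := by
  refine abs_le_of_sq_le_sq' ?_ (P.energy_nonneg v q) |>.2
  rw [P.sq_energy hc]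
  linarith [sq_nonneg (P.normB q), mul_nonneg (sq_nonneg P.t) (hc q)]

theorem normB_le_energy (P : SaddlePoint V Q) (hc : ∀ q, 0 ≤ P.c q q) (v : V) (q : Q) :
    P.normB q ≤ P.energy v q := by
  refine abs_le_of_sq_le_sq' ?_ (P.energy_nonneg v q) |>.2
  rw [P.sq_energy hc]
  linarith [sq_nonneg (P.normV v), mul_nonneg (sq_nonneg P.t) (hc q)]

theorem mul_c_le_sq_energy (P : SaddlePoint V Q) (hc : ∀ q, 0 ≤ P.c q q) (v : V) (q : Q) :
    P.t ^ 2 * P.c q q ≤ P.energy v q ^ 2 := by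
  rw [P.sq_energy hc]
  linarith [sq_nonneg (P.normV v), sq_nonneg (P.normB q)]

end

variable {V Q : Type*} [AddCommGroup V] [Module ℝ V] [AddCommGroup Q] [Module ℝ Q]

namespace Setting

variable {P : SaddlePoint V Q} {C : ℝ}

/-- The form `a` as a bilinear map. -/
def linA (hP : P.Setting C) : V →ₗ[ℝ] V →ₗ[ℝ] ℝ :=
  LinearMap.mk₂ ℝ P.a (fun x y v => (hP.bilinear_a.2 v).map_add x y)
    (fun k x v => (hP.bilinear_a.2 v).map_smul k x)
    (fun x v w => (hP.bilinear_a.1 x).map_add v w) (fun k x v => (hP.bilinear_a.1 x).map_smul k v)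

/-- The form `b` as a bilinear map. -/
def linB (hP : P.Setting C) : V →ₗ[ℝ] Q →ₗ[ℝ] ℝ :=
  LinearMap.mk₂ ℝ P.b (fun x y v => (hP.bilinear_b.2 v).map_add x y)
    (fun k x v => (hP.bilinear_b.2 v).map_smul k x)
    (fun x v w => (hP.bilinear_b.1 x).map_add v w) (fun k x v => (hP.bilinear_b.1 x).map_smul k v)

/-- The form `c` as a bilinear map. -/
def linC (hP : P.Setting C) : Q →ₗ[ℝ] Q →ₗ[ℝ] ℝ :=
  LinearMap.mk₂ ℝ P.c (fun x y v => (hP.bilinear_c.2 v).map_add x y)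
    (fun k x v => (hP.bilinear_c.2 v).map_smul k x)
    (fun x v w => (hP.bilinear_c.1 x).map_add v w) (fun k x v => (hP.bilinear_c.1 x).map_smul k v)

@[simp] theorem linA_apply (hP : P.Setting C) (u v : V) : hP.linA u v = P.a u v := rfl

@[simp] theorem linB_apply (hP : P.Setting C) (u : V) (q : Q) : hP.linB u q = P.b u q := rfl

@[simp] theorem linC_apply (hP : P.Setting C) (p q : Q) : hP.linC p q = P.c p q := rfl

/-- The form `(u, p), (v, q) ↦ a(u, v) - b(v, p) + b(u, q) + t² c(p, q)` of the whole system. -/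
def form (hP : P.Setting C) : (V × Q) →ₗ[ℝ] (V × Q) →ₗ[ℝ] ℝ :=
  let pr₁ := LinearMap.fst ℝ V Q
  let pr₂ := LinearMap.snd ℝ V Q
  hP.linA.compl₁₂ pr₁ pr₁ - hP.linB.flip.compl₁₂ pr₂ pr₁ + hP.linB.compl₁₂ pr₁ pr₂ +
    P.t ^ 2 • hP.linC.compl₁₂ pr₂ pr₂

theorem form_apply (hP : P.Setting C) (x y : V × Q) :
    hP.form x y = P.a x.1 y.1 - P.b y.1 x.2 + P.b x.1 y.2 + P.t ^ 2 * P.c x.2 y.2 := by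
  simp [form]

theorem solves_iff (hP : P.Setting C) (F : V →ₗ[ℝ] ℝ) (G : Q →ₗ[ℝ] ℝ) (x : V × Q) :
    P.Solves F G x ↔ ∀ y : V × Q, hP.form x y = F y.1 + G y.2 := by
  constructor
  · rintro ⟨h1, h2⟩ y
    rw [hP.form_apply, h1, add_assoc, h2]
  · intro h
    constructor
    · intro v
      have hb : P.b x.1 0 = 0 := (hP.linB x.1).map_zero
      have hc : P.c x.2 0 = 0 := (hP.linC x.2).map_zero
      have := h (v, 0)
      rw [hP.form_apply] at this
      simpa [hb, hc] using this
    · intro q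
      have ha : P.a x.1 0 = 0 := (hP.linA x.1).map_zero
      have hb : P.b 0 x.2 = 0 := (hP.linB.flip x.2).map_zero
      have := h (0, q)
      rw [hP.form_apply] at this
      simpa [ha, hb] using this

theorem sq_c_le_mul (hP : P.Setting C) (p q : Q) : P.c p q ^ 2 ≤ P.c p p * P.c q q :=
  LinearMap.BilinForm.apply_sq_le_of_symm hP.linC hP.nonneg_c ⟨hP.symm_c⟩ p q

theorem energy_neg_right (hP : P.Setting C) (v : V) (q : Q) : P.energy v (-q) = P.energy v q := by
  have hc : P.c (-q) (-q) = P.c q q := by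
    change hP.linC (-q) (-q) = _
    rw [map_neg, LinearMap.map_neg₂, neg_neg, hP.linC_apply]
  rw [energy, energy, hP.hilbert_b.map_neg, hc]

/-- The energy norm is a Hilbert norm, if `c` is bounded by `‖·‖_b`. -/
theorem hilbert_energy (hP : P.Setting C) {k : ℝ}
    (hck : ∀ q, P.c q q ≤ k * P.normB q ^ 2) :
    IsHilbertNorm fun x : V × Q => P.energy x.1 x.2 where
  nonneg x := P.energy_nonneg _ _
  definite x hx := by
    refine Prod.ext (hP.hilbert_V.definite _ (le_antisymm ?_ (hP.hilbert_V.nonneg _)))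
      (hP.hilbert_b.definite _ (le_antisymm ?_ (hP.hilbert_b.nonneg _)))
    · exact (P.normV_le_energy hP.nonneg_c x.1 x.2).trans_eq hx
    · exact (P.normB_le_energy hP.nonneg_c x.1 x.2).trans_eq hx
  inner_product := by
    obtain ⟨B₁, hs₁, hB₁⟩ := hP.hilbert_V.inner_product
    obtain ⟨B₂, hs₂, hB₂⟩ := hP.hilbert_b.inner_product
    refine ⟨B₁.compl₁₂ (LinearMap.fst ℝ V Q) (LinearMap.fst ℝ V Q) +
      (B₂ + P.t ^ 2 • hP.linC).compl₁₂ (LinearMap.snd ℝ V Q) (LinearMap.snd ℝ V Q),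
      fun x y => ?_, fun x => ?_⟩
    · simp [hs₁ x.1, hs₂ x.2, hP.symm_c x.2]
    · simp [P.sq_energy hP.nonneg_c, hB₁, hB₂, add_assoc]
  complete s hs := by
    obtain ⟨v, hv⟩ := hP.hilbert_V.complete (fun n => (s n).1) fun ε hε => by
      obtain ⟨n₀, h⟩ := hs ε hε
      exact ⟨n₀, fun m hm n hn => (P.normV_le_energy hP.nonneg_c _ _).trans_lt (h m hm n hn)⟩
    obtain ⟨q, hq⟩ := hP.hilbert_b.complete (fun n => (s n).2) fun ε hε => by
      obtain ⟨n₀, h⟩ := hs ε hε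
      exact ⟨n₀, fun m hm n hn => (P.normB_le_energy hP.nonneg_c _ _).trans_lt (h m hm n hn)⟩
    refine ⟨(v, q), ?_⟩
    have hlim : Tendsto (fun n => √(P.normV ((s n).1 - v) ^ 2 +
        (1 + k) * P.normB ((s n).2 - q) ^ 2)) atTop (𝓝 0) := by
      simpa using ((hv.pow 2).add ((hq.pow 2).const_mul (1 + k))).sqrt
    refine squeeze_zero (fun n => P.energy_nonneg _ _) (fun n => ?_) hlim
    refine Real.sqrt_le_sqrt ?_
    have h1 : P.t ^ 2 * P.c ((s n).2 - q) ((s n).2 - q) ≤ P.c ((s n).2 - q) ((s n).2 - q) :=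
      mul_le_of_le_one_left (hP.nonneg_c _) (pow_le_one₀ hP.t_nonneg hP.t_le_one)
    have h2 := hck ((s n).2 - q)
    simp only [Prod.fst_sub, Prod.snd_sub]
    linarith

/-- The form of the system is continuous in the energy norm. -/
theorem abs_form_le (hP : P.Setting 1) (x y : V × Q) :
    |hP.form x y| ≤ 4 * P.energy x.1 x.2 * P.energy y.1 y.2 := by
  have x1 := P.normV_le_energy hP.nonneg_c x.1 x.2
  have x2 := P.normB_le_energy hP.nonneg_c x.1 x.2
  have x3 := P.mul_c_le_sq_energy hP.nonneg_c x.1 x.2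
  have y1 := P.normV_le_energy hP.nonneg_c y.1 y.2
  have y2 := P.normB_le_energy hP.nonneg_c y.1 y.2
  have y3 := P.mul_c_le_sq_energy hP.nonneg_c y.1 y.2
  have ex := P.energy_nonneg x.1 x.2
  have ey := P.energy_nonneg y.1 y.2
  have hV := hP.hilbert_V.nonneg
  have hb := hP.hilbert_b.nonneg
  have ha := hP.continuous_a x.1 y.1
  have hb1 := hP.continuous_b y.1 x.2
  have hb2 := hP.continuous_b x.1 y.2
  have hc : |P.t ^ 2 * P.c x.2 y.2| ≤ P.energy x.1 x.2 * P.energy y.1 y.2 := by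
    refine abs_le_of_sq_le_sq ?_ (mul_nonneg ex ey)
    calc (P.t ^ 2 * P.c x.2 y.2) ^ 2 = P.t ^ 2 * P.t ^ 2 * P.c x.2 y.2 ^ 2 := by ring
      _ ≤ P.t ^ 2 * P.t ^ 2 * (P.c x.2 x.2 * P.c y.2 y.2) := by
          gcongr; exact hP.sq_c_le_mul _ _
      _ = (P.t ^ 2 * P.c x.2 x.2) * (P.t ^ 2 * P.c y.2 y.2) := by ring
      _ ≤ P.energy x.1 x.2 ^ 2 * P.energy y.1 y.2 ^ 2 := by
          gcongr
          exact mul_nonneg (sq_nonneg _) (hP.nonneg_c _)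
      _ = _ := by ring
  have m1 := mul_le_mul x1 y1 (hV _) ex
  have m2 := mul_le_mul y1 x2 (hb _) ey
  have m3 := mul_le_mul x1 y2 (hb _) ex
  rw [one_mul] at ha hb1 hb2
  rw [hP.form_apply]
  rw [abs_le] at *
  constructor <;> nlinarith

theorem mono {C' : ℝ} (hP : P.Setting C) (h : C ≤ C') : P.Setting C' :=
  { hP with
    continuous_a := fun u v => (hP.continuous_a u v).trans <|
      mul_le_mul_of_nonneg_right (mul_le_mul_of_nonneg_right h (hP.hilbert_V.nonneg u))
        (hP.hilbert_V.nonneg v)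
    continuous_b := fun u q => (hP.continuous_b u q).trans <|
      mul_le_mul_of_nonneg_right (mul_le_mul_of_nonneg_right h (hP.hilbert_V.nonneg u))
        (hP.hilbert_b.nonneg q) }

/-- On `Ker B` the form `a` is the square of `‖·‖_V`, and `w p` realises the inf-sup condition. -/
theorem brezzi (hP : P.Setting C) {w : Q → V} {D : V → Q}
    (hwn : ∀ p, P.normV (w p) ≤ P.normB p) (hwb : ∀ p, P.b (w p) p = P.normB p ^ 2)
    (hD : ∀ u, P.normV u ^ 2 = P.a u u + P.c (D u) (D u)) (hb : ∀ u q, P.b u q = P.c (D u) q) :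
    P.Brezzi (1 / 2) where
  coercive v hv := by
    have h := hD v
    rw [← hb v (D v), hv] at h
    linarith [hP.nonneg_a v]
  inf_sup p M hM hle := by
    have h1 : P.b (w p) p ≤ M * P.normV (w p) := hle (w p)
    rw [hwb] at h1
    have h2 := h1.trans (mul_le_mul_of_nonneg_left (hwn p) hM)
    rcases (hP.hilbert_b.nonneg p).eq_or_lt with h | h
    · rwa [← h, mul_zero]
    · rw [sq] at h2
      linarith [le_of_mul_le_mul_right h2 h]

/-- The test function `(u, D u)` gives the Braess condition. -/
theorem braess (hP : P.Setting C) {D : V → Q}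
    (hD : ∀ u, P.normV u ^ 2 = P.a u u + P.c (D u) (D u)) (hb : ∀ u q, P.b u q = P.c (D u) q)
    (hbc : ∀ q, P.normB q ^ 2 ≤ P.c q q) : P.Braess (1 / 2) := by
  intro u M hM hle
  have h1 := hle (u, D u)
  simp only [hb u (D u), ← hD u] at h1
  have h2 : P.energy u (D u) ≤ 2 * P.normV u := by
    refine abs_le_of_sq_le_sq' ?_ (mul_nonneg zero_le_two (hP.hilbert_V.nonneg u)) |>.2
    rw [P.sq_energy hP.nonneg_c]
    have h3 := mul_le_of_le_one_left (hP.nonneg_c (D u))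
      (pow_le_one₀ (n := 2) hP.t_nonneg hP.t_le_one)
    linarith [hbc (D u), hD u, hP.nonneg_a u, sq_nonneg (P.normV u)]
  have h3 := h1.trans (mul_le_mul_of_nonneg_left h2 hM)
  rcases (hP.hilbert_V.nonneg u).eq_or_lt with h | h
  · rwa [← h, mul_zero]
  · have h4 : P.normV u ≤ 2 * M := le_of_mul_le_mul_right (by linarith [sq (P.normV u)]) h
    linarith

/-- Stability from an explicit test function. Let `w : Q → V` realise the inf-sup condition,
`b(w p, p) = ‖p‖_b²` and `‖w p‖_V ≤ ‖p‖_b`, and let `D : V → Q` represent `b` by `c`, with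
`‖u‖_V² = a(u, u) + c(D u, D u)`. Then testing the system at `(u, p)` with
`(u - w p, p + D u)` bounds half of the squared energy norm of `(u, p)` from above,
and this test function is controlled by `(u, p)`. The form is symmetric
up to the sign of the second component, so that the same
estimate for the adjoint system gives existence, by the Lax–Milgram theorem. -/
theorem stable (hP : P.Setting 1) {k : ℝ}
    (hck : ∀ q, P.c q q ≤ k * P.normB q ^ 2) (w : Q →ₗ[ℝ] V) (D : V →ₗ[ℝ] Q)
    (hwn : ∀ p, P.normV (w p) ≤ P.normB p) (hwb : ∀ p, P.b (w p) p = P.normB p ^ 2)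
    (hD : ∀ u, P.normV u ^ 2 = P.a u u + P.c (D u) (D u)) (hb : ∀ u q, P.b u q = P.c (D u) q)
    (hbc : ∀ q, P.normB q ^ 2 ≤ P.c q q) : P.Stable 6 := by
  have hE := hP.hilbert_energy hck
  have ht2 : P.t ^ 2 ≤ 1 := pow_le_one₀ hP.t_nonneg hP.t_le_one
  -- The common lower bound, with `s = 1` for the system and `s = -1` for its adjoint.
  have lower : ∀ (u : V) (p : Q) (s : ℝ), s ^ 2 = 1 → P.energy u p ^ 2 / 2 ≤
      P.a u u + P.c (D u) (D u) + P.normB p ^ 2 + P.t ^ 2 * P.c p p +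
        s * (P.t ^ 2 * P.c p (D u) - P.a u (w p)) := by
    intro u p s hs
    have h1 : 0 ≤ P.a (u - s • w p) (u - s • w p) := hP.nonneg_a _
    have h2 : 0 ≤ P.c (p + s • D u) (p + s • D u) := hP.nonneg_c _
    have e1 : P.a (u - s • w p) (u - s • w p) =
        P.a u u - 2 * s * P.a u (w p) + P.a (w p) (w p) := by
      simp only [← hP.linA_apply, map_sub, map_smul, LinearMap.sub_apply, LinearMap.smul_apply,
        smul_eq_mul]
      rw [hP.linA_apply (w p) u, hP.symm_a (w p) u, hP.linA_apply, hP.linA_apply]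
      linear_combination (hP.linA (w p) (w p)) * hs
    have e2 : P.c (p + s • D u) (p + s • D u) =
        P.c p p + 2 * s * P.c p (D u) + P.c (D u) (D u) := by
      simp only [← hP.linC_apply, map_add, map_smul, LinearMap.add_apply, LinearMap.smul_apply,
        smul_eq_mul]
      rw [hP.linC_apply (D u) p, hP.symm_c (D u) p, hP.linC_apply, hP.linC_apply]
      linear_combination (hP.linC (D u) (D u)) * hs
    have h3 : P.a (w p) (w p) ≤ P.normB p ^ 2 := by
      have := pow_le_pow_left₀ (hP.hilbert_V.nonneg (w p)) (hwn p) 2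
      linarith [hD (w p), hP.nonneg_c (D (w p))]
    have h4 := mul_nonneg (sq_nonneg P.t) h2
    have h5 := mul_le_of_le_one_left (hP.nonneg_c (D u)) ht2
    rw [e1] at h1
    rw [e2] at h4
    rw [P.sq_energy hP.nonneg_c, hD u]
    linarith [sq_nonneg (P.normB p)]
  -- The squared energy of the test function is at most `6 ‖u‖_V² + 4 ‖p‖_b² + 2 t² c(p, p)`.
  have upper : ∀ (u : V) (p : Q), P.energy (u - w p) (p + D u) ≤ 3 * P.energy u p := by
    intro u p
    refine abs_le_of_sq_le_sq' ?_ (mul_nonneg (by norm_num) (P.energy_nonneg u p)) |>.2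
    rw [mul_pow, P.sq_energy hP.nonneg_c, P.sq_energy hP.nonneg_c]
    have h1 := hP.hilbert_V.sub_sq_le u (w p)
    have h2 := hP.hilbert_b.add_sq_le p (D u)
    have h3 := pow_le_pow_left₀ (hP.hilbert_V.nonneg (w p)) (hwn p) 2
    have h4 : P.c (p + D u) (p + D u) ≤ 2 * P.c p p + 2 * P.c (D u) (D u) := by
      have h : 0 ≤ P.c (p - D u) (p - D u) := hP.nonneg_c _
      simp only [← hP.linC_apply, map_add, map_sub, LinearMap.add_apply,
        LinearMap.sub_apply] at h ⊢
      linarith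
    have h5 := mul_le_mul_of_nonneg_left h4 (sq_nonneg P.t)
    have h6 := mul_le_of_le_one_left (hP.nonneg_c (D u)) ht2
    have h7 := mul_nonneg (sq_nonneg P.t) (hP.nonneg_c p)
    linarith [hbc (D u), hD u, hP.nonneg_a u, sq_nonneg (P.normB p), sq_nonneg (P.normV u)]
  have test : ∀ x : V × Q,
      P.energy x.1 x.2 ^ 2 / 2 ≤ hP.form x (x.1 - w x.2, x.2 + D x.1) := by
    rintro ⟨u, p⟩
    refine (lower u p 1 (by norm_num)).trans_eq ?_
    have e1 : P.a u (u - w p) = P.a u u - P.a u (w p) := (hP.linA u).map_sub _ _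
    have e2 : P.b (u - w p) p = P.b u p - P.b (w p) p := (hP.linB.flip p).map_sub _ _
    have e3 : P.b u (p + D u) = P.b u p + P.b u (D u) := (hP.linB u).map_add _ _
    have e4 : P.c p (p + D u) = P.c p p + P.c p (D u) := (hP.linC p).map_add _ _
    rw [hP.form_apply]
    simp only [e1, e2, e3, e4, hwb, hb u (D u)]
    ring
  -- The adjoint test function `(u + w p, p - D u)`, as a linear map. The form
  -- `(z, y) ↦ form (T z) y` is coercive, so that the solution is found in the shape `T z`.
  let T : (V × Q) →ₗ[ℝ] (V × Q) :=
    (LinearMap.fst ℝ V Q + w ∘ₗ LinearMap.snd ℝ V Q).prod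
      (LinearMap.snd ℝ V Q - D ∘ₗ LinearMap.fst ℝ V Q)
  have hT : ∀ x, T x = (x.1 + w x.2, x.2 - D x.1) := fun x => rfl
  have Tupper : ∀ x : V × Q, P.energy (T x).1 (T x).2 ≤ 3 * P.energy x.1 x.2 := by
    rintro ⟨u, p⟩
    have h1 := upper u (-p)
    have h2 : u - w (-p) = u + w p := by rw [map_neg, sub_neg_eq_add]
    have h3 : -p + D u = -(p - D u) := by abel
    rw [h2, h3, hP.energy_neg_right, hP.energy_neg_right] at h1
    exact h1
  have Ttest : ∀ x : V × Q, 1 / 2 * P.energy x.1 x.2 ^ 2 ≤ hP.form (T x) x := by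
    rintro ⟨u, p⟩
    have h := lower u p (-1) (by norm_num)
    refine (le_of_eq (by ring)).trans (h.trans_eq ?_)
    have e1 : P.a (u + w p) u = P.a u u + P.a (w p) u := (hP.linA.flip u).map_add _ _
    have e2 : P.b u (p - D u) = P.b u p - P.b u (D u) := (hP.linB u).map_sub _ _
    have e3 : P.b (u + w p) p = P.b u p + P.b (w p) p := (hP.linB.flip p).map_add _ _
    have e4 : P.c (p - D u) p = P.c p p - P.c (D u) p := (hP.linC.flip p).map_sub _ _
    rw [hP.form_apply, hT]
    simp only [e1, e2, e3, e4, hwb, hb u (D u), hP.symm_a (w p) u, hP.symm_c (D u) p]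
    ring
  -- The constant `12 = 4 · 3` combines the continuity of the form with the bound of `T`.
  intro F G M hM hFG
  let l : (V × Q) →ₗ[ℝ] ℝ := F.coprod G
  have hl : ∀ y : V × Q, |l y| ≤ M * P.energy y.1 y.2 := fun y => hFG y.1 y.2
  obtain ⟨z, hz⟩ := hE.exists_eq_of_coercive (hP.form ∘ₗ T) (by norm_num : (0 : ℝ) < 1 / 2)
    (C := 12) (fun x y => by
      refine (hP.abs_form_le (T x) y).trans ?_
      nlinarith [mul_le_mul_of_nonneg_right (Tupper x) (P.energy_nonneg y.1 y.2)])
    Ttest l hl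
  refine ⟨T z, (hP.solves_iff F G _).2 hz, fun y hy => ?_, ?_⟩
  · have hy' := (hP.solves_iff F G _).1 hy
    have h0 : ∀ x, hP.form (y - T z) x = 0 := fun x => by
      have h1 : hP.form y x = l x := hy' x
      have h2 : hP.form (T z) x = l x := hz x
      rw [LinearMap.map_sub, LinearMap.sub_apply, h1, h2, sub_self]
    have h := test (y - T z)
    rw [h0] at h
    refine sub_eq_zero.1 (hE.definite _ ?_)
    exact pow_eq_zero_iff two_ne_zero |>.1 (le_antisymm (by linarith) (sq_nonneg _))
  · have h1 := test (T z)
    have h2 : hP.form (T z) ((T z).1 - w (T z).2, (T z).2 + D (T z).1) = l _ := hz _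
    have h3 := (le_abs_self _).trans (hl ((T z).1 - w (T z).2, (T z).2 + D (T z).1))
    have h4 := mul_le_mul_of_nonneg_left (upper (T z).1 (T z).2) hM
    have h5 := P.energy_nonneg (T z).1 (T z).2
    rw [h2] at h1
    by_contra! hlt
    have h6 : 0 < P.energy (T z).1 (T z).2 := lt_of_le_of_lt (by positivity) hlt
    nlinarith [mul_lt_mul_of_pos_right hlt h6]

end Setting

end SaddlePoint

/-! ### Passing to a smaller norm `‖·‖_b` -/

namespace SaddlePoint

variable {V Q : Type*} {P : SaddlePoint V Q} {N : Q → ℝ}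

theorem energy_mono (hN0 : ∀ q, 0 ≤ N q) (hN : ∀ q, N q ≤ P.normB q) (v : V) (q : Q) :
    SaddlePoint.energy { P with normB := N } v q ≤ P.energy v q := by
  have := pow_le_pow_left₀ (hN0 q) (hN q) 2
  exact Real.sqrt_le_sqrt (by simpa using this)

theorem Brezzi.mono {β : ℝ} (hβ : 0 ≤ β) (h : P.Brezzi β) (hN : ∀ q, N q ≤ P.normB q) :
    SaddlePoint.Brezzi { P with normB := N } β where
  coercive := h.coercive
  inf_sup p M hM hle := (mul_le_mul_of_nonneg_left (hN p) hβ).trans (h.inf_sup p M hM hle)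

theorem Braess.mono {β : ℝ} (h : P.Braess β) (hN0 : ∀ q, 0 ≤ N q)
    (hN : ∀ q, N q ≤ P.normB q) : SaddlePoint.Braess { P with normB := N } β :=
  fun u M hM hle => h u M hM fun x =>
    (hle x).trans (mul_le_mul_of_nonneg_left (energy_mono hN0 hN x.1 x.2) hM)

variable [AddCommGroup V] [Module ℝ V] [AddCommGroup Q] [Module ℝ Q]

/-- A functional that is bounded in the smaller energy norm is bounded in the larger one, and the
solution, which does not depend on the norms, is bounded in the larger one. -/
theorem Stable.mono {C : ℝ} (h : P.Stable C) (hN0 : ∀ q, 0 ≤ N q)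
    (hN : ∀ q, N q ≤ P.normB q) : SaddlePoint.Stable { P with normB := N } C := by
  intro F G M hM hFG
  obtain ⟨x, hx, huniq, hle⟩ := h F G M hM fun v q =>
    (hFG v q).trans (mul_le_mul_of_nonneg_left (energy_mono hN0 hN v q) hM)
  exact ⟨x, hx, huniq, (energy_mono hN0 hN x.1 x.2).trans hle⟩

end SaddlePoint

/-! ### Coercive operators and sums of Hilbert spaces -/

/-- A symmetric operator `A` on `H`, its inverse `E`, a coercivity constant `k₀` and a bound `k₁`
of `A`. The inverse is part of the data, given by `A_E` as a right inverse. -/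
structure CoerciveOperator (H : Type*) [NormedAddCommGroup H] [InnerProductSpace ℝ H] where
  A : H →ₗ[ℝ] H
  E : H →ₗ[ℝ] H
  k₀ : ℝ
  k₁ : ℝ
  k₀_pos : 0 < k₀
  k₁_pos : 0 < k₁
  symm : ∀ u v, inner ℝ (A u) v = inner ℝ u (A v)
  coercive : ∀ u, k₀ * ‖u‖ ^ 2 ≤ inner ℝ (A u) u
  bounded : ∀ u, ‖A u‖ ≤ k₁ * ‖u‖
  A_E : ∀ u, A (E u) = u

namespace CoerciveOperator

variable {X H : Type*} [NormedAddCommGroup X] [NormedAddCommGroup H] [InnerProductSpace ℝ H]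
  (T : CoerciveOperator H)

theorem nonneg (u : H) : 0 ≤ inner ℝ (T.A u) u :=
  (mul_nonneg T.k₀_pos.le (sq_nonneg _)).trans (T.coercive u)

/-- The Cauchy–Schwarz inequality for the inner product `∫ (K u) · v`. -/
theorem sq_inner_le (u v : H) :
    inner ℝ (T.A u) v ^ 2 ≤ inner ℝ (T.A u) u * inner ℝ (T.A v) v :=
  LinearMap.BilinForm.apply_sq_le_of_symm ((innerₗ (H)) ∘ₗ T.A) T.nonneg
    ⟨fun u v => (T.symm u v).trans (real_inner_comm _ _)⟩ u v

theorem inner_E_eq (u v : H) : inner ℝ (T.E u) v = inner ℝ (T.A (T.E u)) (T.E v) := by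
  rw [T.symm, T.A_E]

theorem inner_E_comm (u v : H) : inner ℝ (T.E u) v = inner ℝ (T.E v) u := by
  rw [T.inner_E_eq, T.symm, real_inner_comm, ← T.inner_E_eq]

theorem inner_E_nonneg (u : H) : 0 ≤ inner ℝ (T.E u) u := by
  rw [T.inner_E_eq]
  exact T.nonneg _

theorem E_A (u : H) : T.E (T.A u) = u := by
  have h := T.coercive (T.E (T.A u) - u)
  rw [map_sub, T.A_E, sub_self, inner_zero_left] at h
  have h1 := nonpos_of_mul_nonpos_right h T.k₀_pos
  exact sub_eq_zero.1 (norm_eq_zero.1 (pow_eq_zero_iff two_ne_zero |>.1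
    (le_antisymm h1 (sq_nonneg _))))

theorem inner_E_neg_A (v : H) : inner ℝ (T.E (-T.A v)) (-T.A v) = inner ℝ (T.A v) v := by
  rw [map_neg, T.E_A, inner_neg_neg, real_inner_comm]

/-- The duality between the weighted norms `‖K^{-1/2} u‖` and `‖K^{1/2} v‖`. -/
theorem sq_inner_le_mul (u v : H) :
    inner ℝ u v ^ 2 ≤ inner ℝ (T.E u) u * inner ℝ (T.A v) v := by
  have h := T.sq_inner_le (T.E u) v
  rwa [← T.inner_E_eq, T.A_E] at h

theorem norm_sq_le_inner_E (u : H) :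
    T.k₀ / T.k₁ ^ 2 * ‖u‖ ^ 2 ≤ inner ℝ (T.E u) u := by
  have h1 : ‖u‖ ≤ T.k₁ * ‖T.E u‖ := by simpa [T.A_E] using T.bounded (T.E u)
  have h2 := pow_le_pow_left₀ (norm_nonneg u) h1 2
  have h3 := T.k₁_pos
  rw [T.inner_E_eq]
  refine le_trans ?_ (T.coercive _)
  rw [div_mul_eq_mul_div, div_le_iff₀ (by positivity), mul_assoc]
  exact mul_le_mul_of_nonneg_left (h2.trans_eq (by ring)) T.k₀_pos.le

theorem inner_E_le_norm_sq (u : H) : inner ℝ (T.E u) u ≤ T.k₀⁻¹ * ‖u‖ ^ 2 := by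
  have h0 := T.k₀_pos
  have h1 := T.coercive (T.E u)
  rw [T.A_E] at h1
  have h2 := h1.trans (real_inner_le_norm u (T.E u))
  have h3 : T.k₀ * ‖T.E u‖ ≤ ‖u‖ := by
    rcases (norm_nonneg (T.E u)).eq_or_lt with h | h
    · rw [← h, mul_zero]; exact norm_nonneg u
    · exact le_of_mul_le_mul_right (by linarith [sq ‖T.E u‖]) h
  refine (real_inner_le_norm _ _).trans ?_
  rw [inv_mul_eq_div, le_div_iff₀ h0, sq]
  nlinarith [mul_le_mul_of_nonneg_right h3 (norm_nonneg u)]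

/-- The norm `(inf_{(r, s) ∈ R} ‖p - r‖² + (A s, s))^{1/2}` of the sum of `X` and the space of
the `r`. -/
def sumNorm (R : Set (X × H)) (p : X) : ℝ :=
  √(⨅ w : R, (‖p - (w : X × H).1‖ ^ 2 + inner ℝ (T.A (w : X × H).2) (w : X × H).2))

theorem sumNorm_nonneg (R : Set (X × H)) (p : X) : 0 ≤ T.sumNorm R p := Real.sqrt_nonneg _

theorem bddBelow_sumNorm (R : Set (X × H)) (p : X) :
    BddBelow (Set.range fun w : R =>
      ‖p - (w : X × H).1‖ ^ 2 + inner ℝ (T.A (w : X × H).2) (w : X × H).2) := by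
  refine ⟨0, ?_⟩
  rintro _ ⟨w, rfl⟩
  exact add_nonneg (sq_nonneg _) (T.nonneg _)

/-- Enlarging the space over which the infimum is taken decreases the norm. -/
theorem sumNorm_anti {R R' : Set (X × H)} (hR : R.Nonempty) (h : R ⊆ R') (p : X) :
    T.sumNorm R' p ≤ T.sumNorm R p := by
  have := hR.to_subtype
  refine Real.sqrt_le_sqrt (le_ciInf fun w => ?_)
  exact ciInf_le (T.bddBelow_sumNorm R' p) (⟨w, h w.2⟩ : R')

variable [InnerProductSpace ℝ X] (G : Submodule ℝ (X × H))

/-- The inner product `(r, r') + (A s, s')` on a subspace of pairs `(r, s)`. -/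
def energyForm : G →ₗ[ℝ] G →ₗ[ℝ] ℝ :=
  let pr₁ := LinearMap.fst ℝ X H ∘ₗ G.subtype
  let pr₂ := LinearMap.snd ℝ X H ∘ₗ G.subtype
  (innerₗ X).compl₁₂ pr₁ pr₁ + ((innerₗ H) ∘ₗ T.A).compl₁₂ pr₂ pr₂

theorem energyForm_apply (r s : G) :
    T.energyForm G r s = inner ℝ r.1.1 s.1.1 + inner ℝ (T.A r.1.2) s.1.2 := rfl

theorem energyForm_comm (r s : G) : T.energyForm G r s = T.energyForm G s r := by
  rw [energyForm_apply, energyForm_apply, T.symm, real_inner_comm, real_inner_comm (T.A s.1.2)]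

theorem energyForm_self_nonneg (r : G) : 0 ≤ T.energyForm G r r := by
  rw [energyForm_apply]
  exact add_nonneg real_inner_self_nonneg (T.nonneg _)

theorem isHilbertNorm_sqrt_energyForm [CompleteSpace X] [CompleteSpace H]
    (hG : IsClosed (G : Set (X × H))) :
    IsHilbertNorm fun r : G => √(T.energyForm G r r) := by
  have : CompleteSpace G := hG.completeSpace_coe
  have hc : 0 < min 1 T.k₀ := lt_min one_pos T.k₀_pos
  have h1 : ∀ r : G, ‖r.1.1‖ ≤ ‖r‖ := fun r => norm_fst_le r.1
  have h2 : ∀ r : G, ‖r.1.2‖ ≤ ‖r‖ := fun r => norm_snd_le r.1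
  refine IsHilbertNorm.of_equivalent (fun r => Real.sqrt_nonneg _) (T.energyForm G)
    (T.energyForm_comm G) (fun r => Real.sq_sqrt (T.energyForm_self_nonneg G r))
    (Real.sqrt_pos.2 hc) (C := √(1 + T.k₁)) (fun r => ?_) fun r => ?_
  · refine Real.le_sqrt_of_sq_le ?_
    rw [mul_pow, Real.sq_sqrt hc.le, energyForm_apply, real_inner_self_eq_norm_sq]
    have h3 := T.coercive r.1.2
    have h4 : ‖r‖ ^ 2 ≤ ‖r.1.1‖ ^ 2 + ‖r.1.2‖ ^ 2 := by
      have : ‖r‖ = max ‖r.1.1‖ ‖r.1.2‖ := Prod.norm_def r.1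
      rcases max_choice ‖r.1.1‖ ‖r.1.2‖ with h | h <;> rw [this, h] <;>
        linarith [sq_nonneg ‖r.1.1‖, sq_nonneg ‖r.1.2‖]
    have h5 := mul_le_mul_of_nonneg_left h4 hc.le
    have h6 := mul_le_mul_of_nonneg_right (min_le_left 1 T.k₀) (sq_nonneg ‖r.1.1‖)
    have h7 := mul_le_mul_of_nonneg_right (min_le_right 1 T.k₀) (sq_nonneg ‖r.1.2‖)
    linarith
  · rw [← Real.sqrt_sq (norm_nonneg r), ← Real.sqrt_mul (by linarith [T.k₁_pos])]
    refine Real.sqrt_le_sqrt ?_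
    rw [energyForm_apply, real_inner_self_eq_norm_sq]
    have h3 := real_inner_le_norm (T.A r.1.2) r.1.2
    have h4 := mul_le_mul_of_nonneg_right (T.bounded r.1.2) (norm_nonneg r.1.2)
    have h5 := mul_le_mul_of_nonneg_left (pow_le_pow_left₀ (norm_nonneg _) (h2 r) 2) T.k₁_pos.le
    have h6 := pow_le_pow_left₀ (norm_nonneg _) (h1 r) 2
    linarith [sq ‖r.1.2‖]

/-- The solution `(r, s)` of `(r, r') + (A s, s') = (p, r')` for all `(r', s')`, as a linear
function of `p`. It is the minimizer in the definition of the norm `sumNorm` of `p`. -/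
theorem exists_solution_operator [CompleteSpace X] [CompleteSpace H]
    (hG : IsClosed (G : Set (X × H))) : ∃ S : X →ₗ[ℝ] G,
    ∀ p r, T.energyForm G (S p) r = inner ℝ p r.1.1 := by
  have hsq : ∀ r : G, √(T.energyForm G r r) ^ 2 = T.energyForm G r r :=
    fun r => Real.sq_sqrt (T.energyForm_self_nonneg G r)
  refine (T.isHilbertNorm_sqrt_energyForm G hG).exists_linearMap_of_coercive (T.energyForm G)
    one_pos
    (C := 1) (fun r s => ?_) (fun r => by rw [one_mul, hsq])
    ((innerₗ (X)).compl₂ (LinearMap.fst ℝ (X) (H) ∘ₗ G.subtype))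
    fun p => ⟨‖p‖, fun r => ?_⟩
  · refine abs_le_of_sq_le_sq ?_ (by positivity)
    rw [one_mul, mul_pow, hsq, hsq]
    exact LinearMap.BilinForm.apply_sq_le_of_symm (T.energyForm G) (T.energyForm_self_nonneg G)
      ⟨T.energyForm_comm G⟩ r s
  · refine (abs_real_inner_le_norm p r.1.1).trans ?_
    refine mul_le_mul_of_nonneg_left (Real.le_sqrt_of_sq_le ?_) (norm_nonneg p)
    rw [energyForm_apply, real_inner_self_eq_norm_sq]
    linarith [T.nonneg r.1.2]

section Minimizer

variable {T G} {S : X →ₗ[ℝ] G} (hS : ∀ p r, T.energyForm G (S p) r = inner ℝ p r.1.1)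

include hS

/-- The square of the norm in terms of the minimizer. -/
theorem sq_sumNorm (p : X) : T.sumNorm (G : Set (X × H)) p ^ 2 =
    ‖p - (S p).1.1‖ ^ 2 + inner ℝ (T.A (S p).1.2) (S p).1.2 := by
  have hlow : ∀ s : G, ‖p - (S p).1.1‖ ^ 2 + inner ℝ (T.A (S p).1.2) (S p).1.2 ≤
      ‖p - s.1.1‖ ^ 2 + inner ℝ (T.A s.1.2) s.1.2 := by
    intro s
    -- With `s = S p + t`, the two sides differ by the energy of `t`.
    have h0 := T.energyForm_self_nonneg G (s - S p)
    have h1 := hS p s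
    have h2 := hS p (S p)
    have h3 : T.energyForm G (s - S p) (s - S p) =
        T.energyForm G s s - 2 * T.energyForm G (S p) s + T.energyForm G (S p) (S p) := by
      simp only [map_sub, LinearMap.sub_apply, T.energyForm_comm G s (S p)]
      ring
    rw [h3, h1, h2, energyForm_apply, real_inner_self_eq_norm_sq] at h0
    rw [energyForm_apply, real_inner_self_eq_norm_sq] at h2
    rw [norm_sub_sq_real, norm_sub_sq_real]
    linarith
  have hne : Nonempty (G : Set (X × H)) := ⟨S p⟩
  rw [sumNorm, Real.sq_sqrt]
  · exact le_antisymm (ciInf_le (T.bddBelow_sumNorm _ p) (S p)) (le_ciInf hlow)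
  · exact le_ciInf fun w => (add_nonneg (sq_nonneg _) (T.nonneg _)).trans (hlow w)

theorem sq_sumNorm_eq_inner (p : X) :
    T.sumNorm (G : Set (X × H)) p ^ 2 = inner ℝ (p - (S p).1.1) p := by
  have h := hS p (S p)
  rw [energyForm_apply, real_inner_self_eq_norm_sq] at h
  rw [sq_sumNorm hS, norm_sub_sq_real, inner_sub_left, real_inner_self_eq_norm_sq,
    real_inner_comm p]
  linarith

theorem sumNorm_le_norm (p : X) : T.sumNorm (G : Set (X × H)) p ≤ ‖p‖ := by
  refine abs_le_of_sq_le_sq' ?_ (norm_nonneg p) |>.2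
  have h := hS p (S p)
  rw [sq_sumNorm_eq_inner hS, inner_sub_left, real_inner_self_eq_norm_sq, real_inner_comm, ← h]
  linarith [T.energyForm_self_nonneg G (S p)]

/-- If `r` is bounded by `s` on the pairs `(r, s)`, as in the Poincaré inequality, then `sumNorm`
bounds the norm of `X`. -/
theorem exists_norm_sq_le_sumNorm {κ : ℝ} (hκ : ∀ w ∈ G, ‖w.1‖ ≤ κ * ‖w.2‖) :
    ∃ k : ℝ, 0 < k ∧ ∀ p : X, ‖p‖ ^ 2 ≤ k * T.sumNorm (G : Set (X × H)) p ^ 2 := by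
  have hk₀ := T.k₀_pos
  refine ⟨2 + 2 * (κ ^ 2 / T.k₀), by positivity, fun p => ?_⟩
  rw [sq_sumNorm hS]
  set r := S p
  have h1 : ‖p‖ ≤ ‖p - r.1.1‖ + ‖r.1.1‖ := by simpa using norm_add_le (p - r.1.1) r.1.1
  have h2 := pow_le_pow_left₀ (norm_nonneg _) (hκ r.1 r.2) 2
  have h3 : κ ^ 2 * ‖r.1.2‖ ^ 2 ≤ κ ^ 2 / T.k₀ * inner ℝ (T.A r.1.2) r.1.2 := by
    rw [div_mul_eq_mul_div, le_div_iff₀ hk₀, mul_assoc]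
    refine mul_le_mul_of_nonneg_left ?_ (sq_nonneg κ)
    linarith [T.coercive r.1.2]
  have h4 := pow_le_pow_left₀ (norm_nonneg _) h1 2
  have h5 : 0 ≤ κ ^ 2 / T.k₀ * ‖p - r.1.1‖ ^ 2 := by positivity
  linarith [sq_nonneg (‖p - r.1.1‖ - ‖r.1.1‖), T.nonneg r.1.2]

/-- The inner product of `sumNorm`. -/
theorem exists_inner_sumNorm : ∃ B : X →ₗ[ℝ] X →ₗ[ℝ] ℝ, (∀ p q, B p q = B q p) ∧
    ∀ p, T.sumNorm (G : Set (X × H)) p ^ 2 = B p p := by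
  refine ⟨(innerₗ X) ∘ₗ (LinearMap.id - LinearMap.fst ℝ X H ∘ₗ G.subtype ∘ₗ S), fun p q => ?_,
    fun p => ?_⟩
  · change inner ℝ (p - (S p).1.1) q = inner ℝ (q - (S q).1.1) p
    rw [inner_sub_left, inner_sub_left, real_inner_comm q (S p).1.1,
      real_inner_comm p (S q).1.1, ← hS, ← hS, T.energyForm_comm, real_inner_comm]
  · rw [sq_sumNorm_eq_inner hS]
    rfl

theorem isHilbertNorm_sumNorm [CompleteSpace X] {κ : ℝ} (hκ : ∀ w ∈ G, ‖w.1‖ ≤ κ * ‖w.2‖) :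
    IsHilbertNorm (T.sumNorm (G : Set (X × H))) := by
  obtain ⟨B, hsymm, hB⟩ := exists_inner_sumNorm hS
  obtain ⟨k, hk, hle⟩ := exists_norm_sq_le_sumNorm hS hκ
  refine IsHilbertNorm.of_equivalent (T.sumNorm_nonneg _) B hsymm hB
    (inv_pos.2 (Real.sqrt_pos.2 hk)) (C := 1) (fun p => ?_) fun p => ?_
  · rw [inv_mul_le_iff₀ (Real.sqrt_pos.2 hk)]
    refine abs_le_of_sq_le_sq' ?_ (mul_nonneg (Real.sqrt_nonneg _) (T.sumNorm_nonneg _ _)) |>.2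
    rw [mul_pow, Real.sq_sqrt hk.le]
    exact hle p
  · rw [one_mul]
    exact sumNorm_le_norm hS p

theorem isHilbertNorm_sqrt_sumNorm_add [CompleteSpace X] :
    IsHilbertNorm fun p : X => √(T.sumNorm (G : Set (X × H)) p ^ 2 + inner ℝ p p) := by
  obtain ⟨B, hsymm, hB⟩ := exists_inner_sumNorm hS
  refine IsHilbertNorm.of_equivalent (fun p => Real.sqrt_nonneg _) (B + innerₗ X)
    (fun p q => ?_) (fun p => ?_) one_pos (C := √2) (fun p => ?_) fun p => ?_
  · change B p q + inner ℝ p q = B q p + inner ℝ q p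
    rw [hsymm, real_inner_comm]
  · rw [Real.sq_sqrt (add_nonneg (sq_nonneg _) real_inner_self_nonneg), hB]
    rfl
  · refine Real.le_sqrt_of_sq_le ?_
    rw [one_mul, real_inner_self_eq_norm_sq]
    linarith [sq_nonneg (T.sumNorm (G : Set (X × H)) p)]
  · have h := pow_le_pow_left₀ (T.sumNorm_nonneg _ p) (sumNorm_le_norm hS p) 2
    calc √(T.sumNorm (G : Set (X × H)) p ^ 2 + inner ℝ p p) ≤ √(2 * ‖p‖ ^ 2) := by
          refine Real.sqrt_le_sqrt ?_
          rw [real_inner_self_eq_norm_sq]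
          linarith
      _ = √2 * ‖p‖ := by rw [Real.sqrt_mul zero_le_two, Real.sqrt_sq (norm_nonneg p)]

/-- If `(u, s) = - (g, r)` for all `(r, s) ∈ G`, that is if `g` is the divergence of `u`, then
`(g, q) = (g, q - r) - (u, s)`. With the minimizing pair, this bounds `(g, q)` by the norm
`sumNorm` of `q`. -/
theorem sq_inner_le_mul_sq_sumNorm {u : H} {g : X}
    (h : ∀ w ∈ G, inner ℝ u w.2 = - inner ℝ g w.1) (q : X) :
    inner ℝ g q ^ 2 ≤
      (inner ℝ (T.E u) u + ‖g‖ ^ 2) * T.sumNorm (G : Set (X × H)) q ^ 2 := by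
  rw [sq_sumNorm hS]
  have h2 : inner ℝ g q = inner ℝ g (q - (S q).1.1) - inner ℝ u (S q).1.2 := by
    rw [inner_sub_right, h _ (S q).2]
    ring
  have h3 := T.sq_inner_le_mul u (S q).1.2
  have h4 : inner ℝ g (q - (S q).1.1) ^ 2 ≤ ‖g‖ ^ 2 * ‖q - (S q).1.1‖ ^ 2 := by
    rw [← mul_pow]
    exact sq_le_sq.2 ((abs_real_inner_le_norm _ _).trans (le_abs_self _))
  have hα := T.inner_E_nonneg u
  have hβ := T.nonneg (S q).1.2
  rw [h2]
  -- The Cauchy–Schwarz inequality in `ℝ²`.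
  generalize inner ℝ g (q - (S q).1.1) = x at *
  generalize inner ℝ u (S q).1.2 = y at *
  generalize inner ℝ (T.E u) u = a at *
  generalize inner ℝ (T.A (S q).1.2) (S q).1.2 = b at *
  generalize ‖g‖ = c at *
  generalize ‖q - (S q).1.1‖ = e at *
  have h5 : -(2 * (x * y)) ≤ a * e ^ 2 + c ^ 2 * b := by
    refine (neg_le_abs _).trans (abs_le_of_sq_le_sq ?_ (by positivity))
    have h6 := mul_le_mul h4 h3 (sq_nonneg y) (by positivity)
    linarith [sq_nonneg (a * e ^ 2 - c ^ 2 * b)]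
  linarith [sub_sq x y]

end Minimizer

end CoerciveOperator

variable {d : ℕ} {Ω : Set (EuclideanSpace ℝ (Fin d))}

/-! ### Test functions -/

theorem gradient_apply_eq_fderiv (φ : EuclideanSpace ℝ (Fin d) → ℝ)
    (x : EuclideanSpace ℝ (Fin d)) (i : Fin d) :
    gradient φ x i = fderiv ℝ φ x (EuclideanSpace.single i 1) := by
  rw [← inner_gradient_left, EuclideanSpace.inner_single_right]
  simp

namespace IsTestFunction

variable {φ ψ : EuclideanSpace ℝ (Fin d) → ℝ}

theorem differentiable (hφ : IsTestFunction Ω φ) : Differentiable ℝ φ :=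
  hφ.smooth.differentiable (by simp)

theorem continuous_fderiv_apply (hφ : IsTestFunction Ω φ) (v : EuclideanSpace ℝ (Fin d)) :
    Continuous fun x => fderiv ℝ φ x v :=
  (hφ.smooth.continuous_fderiv (by simp)).clm_apply continuous_const

theorem eq_zero_of_notMem (hφ : IsTestFunction Ω φ) {x : EuclideanSpace ℝ (Fin d)}
    (hx : x ∉ Ω) : φ x = 0 :=
  image_eq_zero_of_notMem_tsupport fun h => hx (hφ.support_subset h)

theorem zero : IsTestFunction Ω 0 :=
  ⟨contDiff_const, HasCompactSupport.zero, by simp [tsupport]⟩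

theorem add (hφ : IsTestFunction Ω φ) (hψ : IsTestFunction Ω ψ) : IsTestFunction Ω (φ + ψ) :=
  ⟨hφ.smooth.add hψ.smooth, hφ.compact.add hψ.compact,
    (tsupport_add φ ψ).trans (Set.union_subset hφ.support_subset hψ.support_subset)⟩

theorem const_smul (hφ : IsTestFunction Ω φ) (k : ℝ) : IsTestFunction Ω (k • φ) :=
  ⟨hφ.smooth.const_smul k, hφ.compact.smul_left (f := fun _ => k),
    (tsupport_smul_subset_right (fun _ => k) φ).trans hφ.support_subset⟩

/-- Integration by parts for two test functions. -/
theorem integral_mul_fderiv (hφ : IsTestFunction Ω φ) (hψ : IsTestFunction Ω ψ)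
    (v : EuclideanSpace ℝ (Fin d)) :
    ∫ x in Ω, φ x * fderiv ℝ ψ x v = - ∫ x in Ω, fderiv ℝ φ x v * ψ x := by
  rw [setIntegral_eq_integral_of_forall_compl_eq_zero
      (fun x hx => by rw [hφ.eq_zero_of_notMem hx, zero_mul]),
    setIntegral_eq_integral_of_forall_compl_eq_zero
      (fun x hx => by rw [hψ.eq_zero_of_notMem hx, mul_zero])]
  refine integral_mul_fderiv_eq_neg_fderiv_mul_of_integrable ?_ ?_ ?_
    (fun x _ => hφ.differentiable x) (fun x _ => hψ.differentiable x)
  · exact ((hφ.continuous_fderiv_apply v).mul hψ.smooth.continuous).integrable_of_hasCompactSupport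
      hψ.compact.mul_left
  · exact (hφ.smooth.continuous.mul (hψ.continuous_fderiv_apply v)).integrable_of_hasCompactSupport
      hφ.compact.mul_right
  · exact (hφ.smooth.continuous.mul hψ.smooth.continuous).integrable_of_hasCompactSupport
      hφ.compact.mul_right

/-- Integration by parts against the coordinate `x i`, whose derivative in the direction `i`
is `1`. -/
theorem integral_mul_self_eq (hφ : IsTestFunction Ω φ) (i : Fin d) :
    ∫ x in Ω, φ x * φ x =
      ∫ x in Ω, φ x * (-2 * x i * fderiv ℝ φ x (EuclideanSpace.single i 1)) := by
  rw [setIntegral_eq_integral_of_forall_compl_eq_zero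
      (fun x hx => by rw [hφ.eq_zero_of_notMem hx, zero_mul]),
    setIntegral_eq_integral_of_forall_compl_eq_zero
      (fun x hx => by rw [hφ.eq_zero_of_notMem hx, zero_mul])]
  set v : EuclideanSpace ℝ (Fin d) := EuclideanSpace.single i 1
  let π : EuclideanSpace ℝ (Fin d) →L[ℝ] ℝ := EuclideanSpace.proj i
  have hπ : ∀ x, fderiv ℝ (fun x => π x) x v = 1 := fun x => by
    rw [π.hasFDerivAt.fderiv]
    simp [π, v]
  have hsq : ∀ x, fderiv ℝ (fun x => φ x * φ x) x v = 2 * φ x * fderiv ℝ φ x v := fun x => by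
    have h : HasFDerivAt (fun y => φ y * φ y) (φ x • fderiv ℝ φ x + φ x • fderiv ℝ φ x) x :=
      (hφ.differentiable x).hasFDerivAt.mul (hφ.differentiable x).hasFDerivAt
    rw [h.fderiv]
    simp only [_root_.add_apply, _root_.smul_apply, smul_eq_mul]
    ring
  have hc := hφ.smooth.continuous
  have key := integral_mul_fderiv_eq_neg_fderiv_mul_of_integrable
    (μ := (volume : Measure (EuclideanSpace ℝ (Fin d)))) (f := fun x => π x)
    (g := fun x => φ x * φ x) (v := v) ?_ ?_ ?_ (fun x _ => π.differentiableAt)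
    (fun x _ => (hφ.differentiable x).mul (hφ.differentiable x))
  · simp only [hπ, hsq, one_mul] at key
    rw [← neg_eq_iff_eq_neg] at key
    rw [← key, ← integral_neg]
    refine integral_congr_ae (Eventually.of_forall fun x => ?_)
    change -(x i * (2 * φ x * fderiv ℝ φ x v)) = φ x * (-2 * x i * fderiv ℝ φ x v)
    ring
  · simp only [hπ, one_mul]
    exact (hc.mul hc).integrable_of_hasCompactSupport hφ.compact.mul_right
  · simp only [hsq]
    exact (π.continuous.mul ((continuous_const.mul hc).mul
      (hφ.continuous_fderiv_apply v))).integrable_of_hasCompactSupport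
        (HasCompactSupport.mul_left (HasCompactSupport.mul_right hφ.compact.mul_left))
  · exact (π.continuous.mul (hc.mul hc)).integrable_of_hasCompactSupport
      (HasCompactSupport.mul_left hφ.compact.mul_right)

end IsTestFunction

/-! ### The Sobolev spaces -/

/-- The graph of the gradient on the test functions, as a subspace. -/
def testSubmodule (Ω : Set (EuclideanSpace ℝ (Fin d))) : Submodule ℝ (L2 Ω × L2Vec Ω) where
  carrier := testGraph Ω
  zero_mem' := by
    refine ⟨0, IsTestFunction.zero, Lp.coeFn_zero .., ?_⟩
    filter_upwards [Lp.coeFn_zero (EuclideanSpace ℝ (Fin d)) 2 (volume.restrict Ω)] with x hx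
    rw [Prod.snd_zero, hx]
    simp [gradient]
  add_mem' := by
    rintro z w ⟨φ, hφ, h1, h2⟩ ⟨ψ, hψ, h3, h4⟩
    refine ⟨φ + ψ, hφ.add hψ, (Lp.coeFn_add _ _).trans (h1.add h3), ?_⟩
    refine (Lp.coeFn_add _ _).trans ((h2.add h4).trans (Eventually.of_forall fun x => ?_))
    simp [gradient, fderiv_add (hφ.differentiable x) (hψ.differentiable x)]
  smul_mem' := by
    rintro k z ⟨φ, hφ, h1, h2⟩
    refine ⟨k • φ, hφ.const_smul k, (Lp.coeFn_smul _ _).trans (h1.const_smul k), ?_⟩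
    refine (Lp.coeFn_smul _ _).trans ((h2.const_smul k).trans (Eventually.of_forall fun x => ?_))
    simp [gradient, fderiv_const_smul (hφ.differentiable x)]

/-- The graph of the gradient on `H¹₀(Ω)`, as a subspace. -/
def H10Submodule (Ω : Set (EuclideanSpace ℝ (Fin d))) : Submodule ℝ (L2 Ω × L2Vec Ω) :=
  (testSubmodule Ω).topologicalClosure

theorem coe_H10Submodule : (H10Submodule Ω : Set (L2 Ω × L2Vec Ω)) = H10Graph Ω := rfl

/-- The `i`-th component of a vector field. -/
def component (Ω : Set (EuclideanSpace ℝ (Fin d))) (i : Fin d) : L2Vec Ω →L[ℝ] L2 Ω :=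
  ContinuousLinearMap.compLpL 2 (volume.restrict Ω) (EuclideanSpace.proj i)

theorem coeFn_component (i : Fin d) (u : L2Vec Ω) :
    component Ω i u =ᵐ[volume.restrict Ω] fun x => u x i :=
  ContinuousLinearMap.coeFn_compLpL _ _

theorem integral_mul_component (i : Fin d) (f : L2 Ω) (u : L2Vec Ω) :
    ∫ x in Ω, f x * u x i = inner ℝ f (component Ω i u) := by
  rw [L2.inner_def]
  refine integral_congr_ae ?_
  filter_upwards [coeFn_component i u] with x hx
  rw [hx]
  simp [mul_comm]

theorem H10Graph_subset_H1Graph : H10Graph Ω ⊆ H1Graph Ω := by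
  have hclosed : IsClosed (H1Graph Ω) := by
    have : H1Graph Ω = ⋂ z ∈ testGraph Ω, ⋂ i : Fin d,
        {w | inner ℝ w.1 (component Ω i z.2) = - inner ℝ z.1 (component Ω i w.2)} := by
      ext w
      simp only [H1Graph, ← integral_mul_component, Set.mem_iInter, Set.mem_ofPred_eq]
      simp_rw [mul_comm]
    rw [this]
    refine isClosed_biInter fun z _ => isClosed_iInter fun i => isClosed_eq ?_ ?_ <;> fun_prop
  refine closure_minimal ?_ hclosed
  rintro w ⟨φ, hφ, h1, h2⟩ z ⟨ψ, hψ, h3, h4⟩ i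
  have e1 : ∫ x in Ω, w.1 x * z.2 x i =
      ∫ x in Ω, φ x * fderiv ℝ ψ x (EuclideanSpace.single i 1) := by
    refine integral_congr_ae ?_
    filter_upwards [h1, h4] with x hx hx'
    rw [hx, hx', gradient_apply_eq_fderiv]
  have e2 : ∫ x in Ω, w.2 x i * z.1 x =
      ∫ x in Ω, fderiv ℝ φ x (EuclideanSpace.single i 1) * ψ x := by
    refine integral_congr_ae ?_
    filter_upwards [h2, h3] with x hx hx'
    rw [hx, hx', gradient_apply_eq_fderiv]
  rw [e1, e2, hφ.integral_mul_fderiv hψ]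

/-- The Poincaré inequality on `H¹₀(Ω)`. For a test function `φ` on `Ω ⊆ {|x| ≤ R}`, integration by
parts against `x i` gives `∫ φ² = - 2 ∫ x i φ ∂ᵢφ ≤ 2 R ‖φ‖ ‖∇φ‖`. -/
theorem exists_norm_fst_le (hd : 0 < d) (hb : Bornology.IsBounded Ω) (hm : MeasurableSet Ω) :
    ∃ k : ℝ, 0 ≤ k ∧ ∀ w ∈ H10Graph Ω, ‖w.1‖ ≤ k * ‖w.2‖ := by
  obtain ⟨R, hR0, hR⟩ := hb.exists_pos_norm_le
  refine ⟨2 * R, by positivity, ?_⟩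
  have hclosed : IsClosed {w : L2 Ω × L2Vec Ω | ‖w.1‖ ≤ 2 * R * ‖w.2‖} :=
    isClosed_le (by fun_prop) (by fun_prop)
  refine closure_minimal ?_ hclosed
  rintro z ⟨φ, hφ, h1, h2⟩
  let i : Fin d := ⟨0, hd⟩
  let g : EuclideanSpace ℝ (Fin d) → ℝ :=
    fun x => -2 * x i * fderiv ℝ φ x (EuclideanSpace.single i 1)
  have hg : MemLp g 2 (volume.restrict Ω) := by
    refine Continuous.memLp_of_hasCompactSupport ?_ ?_
    · exact (by fun_prop : Continuous fun x : EuclideanSpace ℝ (Fin d) => -2 * x i).mul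
        (hφ.continuous_fderiv_apply _)
    · exact HasCompactSupport.mul_left (hφ.compact.fderiv_apply ℝ _)
  have hnorm : ‖hg.toLp g‖ ≤ 2 * R * ‖z.2‖ := by
    refine Lp.norm_le_mul_norm_of_ae_le_mul ?_
    filter_upwards [hg.coeFn_toLp, h2, ae_restrict_mem hm] with x hx hx' hxΩ
    rw [hx, hx']
    have e1 : ‖x i‖ ≤ R := (PiLp.norm_apply_le x i).trans (hR x hxΩ)
    have e2 := PiLp.norm_apply_le (gradient φ x) i
    rw [gradient_apply_eq_fderiv] at e2
    calc ‖g x‖ = 2 * ‖x i‖ * ‖fderiv ℝ φ x (EuclideanSpace.single i 1)‖ := by simp [g]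
      _ ≤ 2 * R * ‖gradient φ x‖ := by gcongr
  have hsq : ‖z.1‖ * ‖z.1‖ = inner ℝ z.1 (hg.toLp g) := by
    rw [← real_inner_self_eq_norm_mul_norm, L2.inner_def, L2.inner_def]
    have e1 : ∫ x in Ω, inner ℝ (z.1 x) (z.1 x) = ∫ x in Ω, φ x * φ x := by
      refine integral_congr_ae ?_
      filter_upwards [h1] with x hx
      rw [hx]; simp [sq]
    have e2 : ∫ x in Ω, inner ℝ (z.1 x) (hg.toLp g x) = ∫ x in Ω, φ x * g x := by
      refine integral_congr_ae ?_
      filter_upwards [h1, hg.coeFn_toLp] with x hx hx'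
      rw [hx, hx']; simp [mul_comm]
    rw [e1, e2, hφ.integral_mul_self_eq i]
  have hle := real_inner_le_norm z.1 (hg.toLp g)
  rw [← hsq] at hle
  rcases (norm_nonneg z.1).eq_or_lt with h0 | h0
  · exact h0.symm.trans_le (by positivity)
  · exact (le_of_mul_le_mul_left hle h0).trans hnorm

/-! ### The weak divergence -/

/-- The test functions separate the points of `L²(Ω)`. -/
theorem eq_zero_of_forall_inner_eq_zero (hΩ : IsOpen Ω) {g : L2 Ω}
    (h : ∀ z ∈ testGraph Ω, inner ℝ g z.1 = 0) : g = 0 := by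
  have hloc : LocallyIntegrableOn g Ω volume :=
    locallyIntegrableOn_of_locallyIntegrable_restrict
      ((Lp.memLp g).locallyIntegrable one_le_two)
  have hae := hΩ.ae_eq_zero_of_integral_contDiff_smul_eq_zero hloc fun φ hs hc hsub => by
    have hφ : IsTestFunction Ω φ := ⟨hs, hc, hsub⟩
    obtain ⟨z, hz, h1, -⟩ := exists_mem_testGraph hφ
    rw [← setIntegral_eq_integral_of_forall_compl_eq_zero (s := Ω)
      (fun x hx => by rw [hφ.eq_zero_of_notMem hx, zero_smul]), ← h z hz, L2.inner_def]
    refine integral_congr_ae ?_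
    filter_upwards [h1] with x hx
    rw [hx]; simp
  refine Lp.ext ?_
  filter_upwards [(ae_restrict_iff' hΩ.measurableSet).2 hae,
    Lp.coeFn_zero ℝ 2 (volume.restrict Ω)] with x hx hx'
  rw [hx, hx']; rfl

theorem HasWeakDiv.unique (hΩ : IsOpen Ω) {u : L2Vec Ω} {g g' : L2 Ω} (h : HasWeakDiv Ω u g)
    (h' : HasWeakDiv Ω u g') : g = g' := by
  refine sub_eq_zero.1 (eq_zero_of_forall_inner_eq_zero hΩ fun z hz => ?_)
  rw [inner_sub_left]
  linarith [h z hz, h' z hz]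

/-- By density, the functions in `H¹₀(Ω)` may replace the test functions in the definition of
the weak divergence. -/
theorem HasWeakDiv.inner_eq {u : L2Vec Ω} {g : L2 Ω} (h : HasWeakDiv Ω u g)
    {w : L2 Ω × L2Vec Ω} (hw : w ∈ H10Graph Ω) : inner ℝ u w.2 = - inner ℝ g w.1 := by
  have hc : IsClosed {w : L2 Ω × L2Vec Ω | inner ℝ u w.2 = - inner ℝ g w.1} :=
    isClosed_eq (by fun_prop) (by fun_prop)
  exact closure_minimal h hc hw

theorem hasWeakDiv_weakDiv (u : HDiv Ω) : HasWeakDiv Ω (u : L2Vec Ω) (weakDiv u) :=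
  Classical.choose_spec u.2

theorem weakDiv_eq (hΩ : IsOpen Ω) {u : HDiv Ω} {g : L2 Ω} (h : HasWeakDiv Ω (u : L2Vec Ω) g) :
    weakDiv u = g :=
  (hasWeakDiv_weakDiv u).unique hΩ h

/-- The weak divergence as a linear map. -/
def weakDivₗ (hΩ : IsOpen Ω) : HDiv Ω →ₗ[ℝ] L2 Ω where
  toFun := weakDiv
  map_add' u v := weakDiv_eq hΩ fun z hz => by
    rw [Submodule.coe_add, inner_add_left, inner_add_left, hasWeakDiv_weakDiv u z hz,
      hasWeakDiv_weakDiv v z hz]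
    ring
  map_smul' k u := weakDiv_eq hΩ fun z hz => by
    rw [Submodule.coe_smul, real_inner_smul_left, RingHom.id_apply, real_inner_smul_left,
      hasWeakDiv_weakDiv u z hz]
    ring

variable {K : EuclideanSpace ℝ (Fin d) → Matrix (Fin d) (Fin d) ℝ}

/-! ### The coefficient as an operator -/

/-- A symmetric matrix whose quadratic form lies between `0` and `k` has norm at most `k`. -/
theorem mulVec_dotProduct_mulVec_le {ι : Type*} [Fintype ι] [DecidableEq ι] {S : Matrix ι ι ℝ}
    (hS : S.IsSymm) {k : ℝ} (h0 : ∀ ξ, 0 ≤ (S *ᵥ ξ) ⬝ᵥ ξ)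
    (hk : ∀ ξ, (S *ᵥ ξ) ⬝ᵥ ξ ≤ k * (ξ ⬝ᵥ ξ)) (ξ : ι → ℝ) :
    (S *ᵥ ξ) ⬝ᵥ (S *ᵥ ξ) ≤ k ^ 2 * (ξ ⬝ᵥ ξ) := by
  have hB : ∀ x y, Matrix.toLinearMap₂' ℝ S x y = (S *ᵥ x) ⬝ᵥ y := fun x y => by
    rw [Matrix.toLinearMap₂'_apply', Matrix.dotProduct_mulVec, ← Matrix.mulVec_transpose, hS.eq]
  have hsymm : ∀ x y, (S *ᵥ x) ⬝ᵥ y = (S *ᵥ y) ⬝ᵥ x := fun x y => by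
    rw [dotProduct_comm, Matrix.dotProduct_mulVec, ← Matrix.mulVec_transpose, hS.eq]
  have key := LinearMap.BilinForm.apply_sq_le_of_symm (Matrix.toLinearMap₂' ℝ S)
    (fun x => by rw [hB]; exact h0 x) ⟨fun x y => by
      rw [hB, RingHom.id_apply, hB]; exact hsymm x y⟩ ξ (S *ᵥ ξ)
  simp only [hB] at key
  set η := S *ᵥ ξ
  have hη : 0 ≤ η ⬝ᵥ η := Finset.sum_nonneg fun i _ => mul_self_nonneg _
  have h1 := mul_le_mul (hk ξ) (hk η) (h0 η) ((h0 ξ).trans (hk ξ))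
  rcases hη.eq_or_lt with h | h
  · rw [← h]
    exact mul_nonneg (sq_nonneg k) (Finset.sum_nonneg fun i _ => mul_self_nonneg _)
  · exact le_of_mul_le_mul_right (by linarith [sq (η ⬝ᵥ η)]) h

/-- The operators `A u = K u` and `E u = K⁻¹ u` on `L²(Ω)^d`. -/
structure WeightOperators (Ω : Set (EuclideanSpace ℝ (Fin d)))
    (K : EuclideanSpace ℝ (Fin d) → Matrix (Fin d) (Fin d) ℝ) extends
    CoerciveOperator (L2Vec Ω) where
  weightedInner_eq : ∀ u v, weightedInner K u v = inner ℝ (A u) v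
  weightedInner_inv_eq : ∀ u v, weightedInner (fun x => (K x)⁻¹) u v = inner ℝ (E u) v

/-- The matrices `K x` are bounded uniformly in `x`, so that multiplication by `K` preserves
`L²(Ω)^d`. -/
theorem IsCoefficient.exists_norm_mulVec_le_and_memLp (hK : IsCoefficient Ω K)
    (hm : MeasurableSet Ω) :
    ∃ k : ℝ, 0 < k ∧ (∀ x ∈ Ω, ∀ ξ : EuclideanSpace ℝ (Fin d),
        ‖WithLp.toLp 2 (K x *ᵥ ξ.ofLp)‖ ≤ k * ‖ξ‖) ∧
      ∀ u : L2Vec Ω, MemLp (fun x => WithLp.toLp 2 (K x *ᵥ (u x).ofLp)) 2 (volume.restrict Ω) := by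
  obtain ⟨k₀, k₁, h0, hK'⟩ := hK.elliptic
  have hnn : ∀ ξ : Fin d → ℝ, 0 ≤ ξ ⬝ᵥ ξ := fun ξ => Finset.sum_nonneg fun i _ => mul_self_nonneg _
  have hsq : ∀ ξ : EuclideanSpace ℝ (Fin d), ‖ξ‖ ^ 2 = ξ.ofLp ⬝ᵥ ξ.ofLp := fun ξ => by
    rw [EuclideanSpace.real_norm_sq_eq]
    simp [dotProduct, sq]
  have hk : 0 < max k₁ 1 := lt_max_of_lt_right one_pos
  have hbound : ∀ x ∈ Ω, ∀ ξ : EuclideanSpace ℝ (Fin d),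
      ‖WithLp.toLp 2 (K x *ᵥ ξ.ofLp)‖ ≤ max k₁ 1 * ‖ξ‖ := fun x hx ξ => by
    refine abs_le_of_sq_le_sq' ?_ (by positivity) |>.2
    rw [mul_pow, hsq, hsq]
    exact mulVec_dotProduct_mulVec_le (hK.symm x hx)
      (fun ξ => (mul_nonneg h0.le (hnn ξ)).trans (hK' x hx ξ).1)
      (fun ξ => (hK' x hx ξ).2.trans (mul_le_mul_of_nonneg_right (le_max_left _ _) (hnn ξ))) _
  refine ⟨max k₁ 1, hk, hbound, fun u => ?_⟩
  refine (Lp.memLp u).of_le_mul (c := max k₁ 1) ?_ ?_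
  · refine Measurable.aestronglyMeasurable ?_
    refine (WithLp.measurable_toLp 2 _).comp (measurable_pi_lambda _ fun i => ?_)
    change Measurable fun x => ∑ j, K x i j * u x j
    refine Finset.measurable_sum _ fun j _ => (hK.measurable i j).mul ?_
    exact (EuclideanSpace.proj (𝕜 := ℝ) j).continuous.measurable.comp
      (Lp.stronglyMeasurable u).measurable
  · filter_upwards [ae_restrict_mem hm] with x hx
    exact hbound x hx _

/-- Multiplication by `K` is coercive on `L²(Ω)^d`, hence invertible by the Lax–Milgram theorem, and
its inverse is almost everywhere multiplication by `K⁻¹`. The measurability of `K⁻¹` is not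
needed. -/
theorem IsCoefficient.nonempty_weightOperators (hK : IsCoefficient Ω K) (hm : MeasurableSet Ω) :
    Nonempty (WeightOperators Ω K) := by
  obtain ⟨k, hk, hbound, hmem⟩ := hK.exists_norm_mulVec_le_and_memLp hm
  obtain ⟨k₀, k₁, h0, hK'⟩ := hK.elliptic
  have hinner : ∀ ξ η : EuclideanSpace ℝ (Fin d), inner ℝ ξ η = ξ.ofLp ⬝ᵥ η.ofLp := fun ξ η => by
    rw [EuclideanSpace.inner_eq_star_dotProduct, dotProduct_comm]
    simp
  let A : L2Vec Ω →ₗ[ℝ] L2Vec Ω :=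
    { toFun := fun u => (hmem u).toLp _
      map_add' := fun u v => by
        refine Lp.ext ?_
        filter_upwards [(hmem (u + v)).coeFn_toLp, (hmem u).coeFn_toLp, (hmem v).coeFn_toLp,
          Lp.coeFn_add u v, Lp.coeFn_add ((hmem u).toLp _) ((hmem v).toLp _)] with x h1 h2 h3 h4 h5
        rw [h1, h5, Pi.add_apply, h2, h3, h4, Pi.add_apply, WithLp.ofLp_add, Matrix.mulVec_add,
          WithLp.toLp_add]
      map_smul' := fun c u => by
        refine Lp.ext ?_
        filter_upwards [(hmem (c • u)).coeFn_toLp, (hmem u).coeFn_toLp,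
          Lp.coeFn_smul c u, Lp.coeFn_smul c ((hmem u).toLp _)] with x h1 h2 h3 h4
        rw [RingHom.id_apply, h1, h4, Pi.smul_apply, h2, h3, Pi.smul_apply, WithLp.ofLp_smul,
          Matrix.mulVec_smul, WithLp.toLp_smul] }
  have hA : ∀ u, A u =ᵐ[volume.restrict Ω] fun x => WithLp.toLp 2 (K x *ᵥ (u x).ofLp) :=
    fun u => (hmem u).coeFn_toLp
  have hAin : ∀ u v, weightedInner K u v = inner ℝ (A u) v := fun u v => by
    rw [weightedInner, L2.inner_def]
    refine integral_congr_ae ?_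
    filter_upwards [hA u] with x hx
    rw [hx, hinner]
  have hsymm : ∀ u v, inner ℝ (A u) v = inner ℝ u (A v) := fun u v => by
    rw [L2.inner_def, L2.inner_def]
    refine integral_congr_ae ?_
    filter_upwards [hA u, hA v, ae_restrict_mem hm] with x h1 h2 hx
    rw [h1, h2, hinner, hinner, Matrix.dotProduct_mulVec, ← Matrix.mulVec_transpose,
      (hK.symm x hx).eq]
  have hcoer : ∀ u, k₀ * ‖u‖ ^ 2 ≤ inner ℝ (A u) u := fun u => by
    rw [← real_inner_self_eq_norm_sq, L2.inner_def, L2.inner_def, ← integral_const_mul]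
    refine integral_mono_ae ((L2.integrable_inner u u).const_mul _)
      (L2.integrable_inner (A u) u) ?_
    filter_upwards [hA u, ae_restrict_mem hm] with x h1 hx
    rw [h1, hinner, hinner]
    exact (hK' x hx _).1
  have hbd : ∀ u, ‖A u‖ ≤ k * ‖u‖ := fun u => by
    refine Lp.norm_le_mul_norm_of_ae_le_mul ?_
    filter_upwards [hA u, ae_restrict_mem hm] with x h1 hx
    rw [h1]
    exact hbound x hx _
  have hN : IsHilbertNorm fun u : L2Vec Ω => ‖u‖ :=
    IsHilbertNorm.of_equivalent norm_nonneg (innerₗ _)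
      (fun x y => real_inner_comm (F := L2Vec Ω) y x)
      (fun x => by simp) one_pos (fun x => (one_mul _).le) (fun x => (one_mul _).ge)
  obtain ⟨E, hE⟩ := hN.exists_linearMap_of_coercive ((innerₗ _) ∘ₗ A) h0
    (fun x y => (abs_real_inner_le_norm _ _).trans
      (mul_le_mul_of_nonneg_right (hbd x) (norm_nonneg y))) hcoer
    (innerₗ (L2Vec Ω)) (fun y => ⟨‖y‖, fun x => abs_real_inner_le_norm y x⟩)
  have hAE : ∀ u, A (E u) = u := fun u => ext_inner_right ℝ fun v => hE u v
  refine ⟨⟨⟨A, E, k₀, k, h0, hk, hsymm, hcoer, hbd, hAE⟩, hAin, fun u v => ?_⟩⟩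
  rw [weightedInner, L2.inner_def]
  refine integral_congr_ae ?_
  have h1 := hA (E u)
  rw [hAE] at h1
  filter_upwards [h1, ae_restrict_mem hm] with x h1 hx
  have hinj : Function.Injective (K x).mulVec := by
    refine (injective_iff_map_eq_zero (K x).mulVecLin).2 fun ξ hξ => ?_
    have h2 := (hK' x hx ξ).1
    rw [Matrix.mulVecLin_apply] at hξ
    rw [hξ, zero_dotProduct] at h2
    exact dotProduct_self_eq_zero.1 (le_antisymm (nonpos_of_mul_nonpos_right h2 h0)
      (Finset.sum_nonneg fun i _ => mul_self_nonneg _))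
  have hunit : IsUnit (K x).det :=
    (Matrix.isUnit_iff_isUnit_det _).1 (Matrix.mulVec_injective_iff_isUnit.1 hinj)
  rw [hinner, h1, Matrix.mulVec_mulVec, Matrix.nonsing_inv_mul _ hunit, Matrix.one_mulVec]

namespace WeightOperators

/-! ### The space `V` -/

theorem sq_normV (O : WeightOperators Ω K) (u : HDiv Ω) :
    normV K u ^ 2 = inner ℝ (O.E (u : L2Vec Ω)) (u : L2Vec Ω) + ‖weakDiv u‖ ^ 2 := by
  rw [normV, O.weightedInner_inv_eq, Real.sq_sqrt]
  exact add_nonneg (O.inner_E_nonneg _) (sq_nonneg _)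

theorem isHilbertNorm_normV (O : WeightOperators Ω K) (hΩ : IsOpen Ω) :
    IsHilbertNorm (normV (Ω := Ω) K) := by
  have hc : 0 < O.k₀ / O.k₁ ^ 2 := div_pos O.k₀_pos (pow_pos O.k₁_pos 2)
  have hu : ∀ u : HDiv Ω, √(O.k₀ / O.k₁ ^ 2) * ‖(u : L2Vec Ω)‖ ≤ normV K u := fun u => by
    refine Real.le_sqrt_of_sq_le ?_
    rw [mul_pow, Real.sq_sqrt hc.le, O.weightedInner_inv_eq]
    linarith [O.norm_sq_le_inner_E u, sq_nonneg ‖weakDiv u‖]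
  have hd : ∀ u : HDiv Ω, ‖weakDiv u‖ ≤ normV K u := fun u => by
    refine Real.le_sqrt_of_sq_le ?_
    rw [O.weightedInner_inv_eq]
    linarith [O.inner_E_nonneg u]
  have hc' := Real.sqrt_pos.2 hc
  refine ⟨fun u => Real.sqrt_nonneg _, fun u h => ?_, ?_, fun s hs => ?_⟩
  · have h1 := nonpos_of_mul_nonpos_right ((hu u).trans_eq h) hc'
    exact Subtype.ext (norm_le_zero_iff.1 h1)
  · refine ⟨((innerₗ (L2Vec Ω)) ∘ₗ O.E).compl₁₂ (HDiv Ω).subtype (HDiv Ω).subtype +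
      (innerₗ (L2 Ω)).compl₁₂ (weakDivₗ hΩ) (weakDivₗ hΩ), fun u v => ?_, fun u => ?_⟩
    · change inner ℝ (O.E u) (v : L2Vec Ω) + inner ℝ (weakDiv u) (weakDiv v) =
        inner ℝ (O.E v) (u : L2Vec Ω) + inner ℝ (weakDiv v) (weakDiv u)
      rw [O.inner_E_comm, real_inner_comm (weakDiv u)]
    · rw [O.sq_normV, ← real_inner_self_eq_norm_sq]
      rfl
  · have hcau : ∀ (E : Type) [NormedAddCommGroup E] (f : HDiv Ω → E) (c : ℝ), 0 < c →
        (∀ u v, c * ‖f u - f v‖ ≤ normV K (u - v)) → CauchySeq fun n => f (s n) := by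
      intro E _ f c hc hf
      refine Metric.cauchySeq_iff.2 fun ε hε => ?_
      obtain ⟨n₀, h⟩ := hs (c * ε) (by positivity)
      refine ⟨n₀, fun m hm n hn => ?_⟩
      rw [dist_eq_norm]
      exact lt_of_mul_lt_mul_left ((hf _ _).trans_lt (h m hm n hn)) hc.le
    have hsub : ∀ u v : HDiv Ω, weakDiv (u - v) = weakDiv u - weakDiv v :=
      fun u v => (weakDivₗ hΩ).map_sub u v
    obtain ⟨u, hu'⟩ := cauchySeq_tendsto_of_complete
      (hcau (L2Vec Ω) (fun u => (u : L2Vec Ω)) _ hc' fun u v => hu (u - v))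
    obtain ⟨g, hg⟩ := cauchySeq_tendsto_of_complete
      (hcau (L2 Ω) weakDiv 1 one_pos fun u v => by
        rw [one_mul, ← hsub]
        exact hd (u - v))
    -- The weak divergence is closed, so that `g` is the weak divergence of `u`.
    have hdiv : HasWeakDiv Ω u g := fun z hz =>
      tendsto_nhds_unique (hu'.inner tendsto_const_nhds)
        ((hg.inner tendsto_const_nhds).neg.congr fun n => (hasWeakDiv_weakDiv (s n) z hz).symm)
    let x : HDiv Ω := ⟨u, g, hdiv⟩
    have hx : weakDiv x = g := weakDiv_eq hΩ hdiv
    refine ⟨x, ?_⟩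
    have h1 : Tendsto (fun n => √(O.k₀⁻¹ * ‖(s n : L2Vec Ω) - u‖ ^ 2 + ‖weakDiv (s n) - g‖ ^ 2))
        atTop (𝓝 0) := by
      have h2 := (tendsto_iff_norm_sub_tendsto_zero.1 hu').pow 2 |>.const_mul O.k₀⁻¹
      have h3 := (tendsto_iff_norm_sub_tendsto_zero.1 hg).pow 2
      simpa using (h2.add h3).sqrt
    refine squeeze_zero (fun n => Real.sqrt_nonneg _) (fun n => Real.sqrt_le_sqrt ?_) h1
    rw [O.weightedInner_inv_eq, hsub, hx]
    exact add_le_add (O.inner_E_le_norm_sq _) le_rfl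

/-! ### The space `Q_b` -/

theorem normB_eq (O : WeightOperators Ω K) (R : Set (L2 Ω × L2Vec Ω)) :
    normB R K = O.sumNorm R := by
  funext p
  simp only [normB, CoerciveOperator.sumNorm, O.weightedInner_eq]

/-- The field `- K ∇r`, where `r` is the minimizer in `‖p‖_b`, has divergence `p - r` and realises
the inf-sup condition. -/
theorem exists_lifting (O : WeightOperators Ω K) (hΩ : IsOpen Ω)
    {S : L2 Ω →ₗ[ℝ] H10Submodule Ω}
    (hS : ∀ p r, O.energyForm (H10Submodule Ω) (S p) r = inner ℝ p r.1.1) :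
    ∃ W : L2 Ω →ₗ[ℝ] HDiv Ω, (∀ p, normV K (W p) ≤ normB (H10Graph Ω) K p) ∧
      ∀ p, inner ℝ (weakDiv (W p)) p = normB (H10Graph Ω) K p ^ 2 := by
  have hdiv : ∀ p, HasWeakDiv Ω (-O.A (S p).1.2) (p - (S p).1.1) := fun p z hz => by
    have h := hS p ⟨z, subset_closure hz⟩
    rw [CoerciveOperator.energyForm_apply] at h
    rw [inner_neg_left, inner_sub_left, ← h]
    ring
  let W : L2 Ω →ₗ[ℝ] HDiv Ω :=
    (-(O.A ∘ₗ LinearMap.snd ℝ (L2 Ω) (L2Vec Ω) ∘ₗ (H10Submodule Ω).subtype ∘ₗ S)).codRestrict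
      (HDiv Ω) fun p => ⟨_, hdiv p⟩
  have hW : ∀ p, (W p : L2Vec Ω) = -O.A (S p).1.2 := fun p => rfl
  have hWd : ∀ p, weakDiv (W p) = p - (S p).1.1 := fun p => weakDiv_eq hΩ (hdiv p)
  rw [O.normB_eq, ← coe_H10Submodule]
  refine ⟨W, fun p => ?_, fun p => ?_⟩
  · refine abs_le_of_sq_le_sq' (le_of_eq ?_) (O.sumNorm_nonneg _ _) |>.2
    have h1 : inner ℝ (O.E (W p : L2Vec Ω)) (W p : L2Vec Ω) =
        inner ℝ (O.A (S p).1.2) (S p).1.2 := by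
      rw [hW]
      exact O.inner_E_neg_A _
    rw [O.sq_normV, h1, hWd]
    exact (add_comm _ _).trans (CoerciveOperator.sq_sumNorm hS p).symm
  · rw [hWd, CoerciveOperator.sq_sumNorm_eq_inner hS]

/-- The continuity of `b` in the norm `‖·‖_b`. -/
theorem abs_inner_weakDiv_le (O : WeightOperators Ω K) {S : L2 Ω →ₗ[ℝ] H10Submodule Ω}
    (hS : ∀ p r, O.energyForm (H10Submodule Ω) (S p) r = inner ℝ p r.1.1)
    (u : HDiv Ω) (q : L2 Ω) :
    |inner ℝ (weakDiv u) q| ≤ normV K u * normB (H10Graph Ω) K q := by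
  refine abs_le_of_sq_le_sq ?_ (mul_nonneg (Real.sqrt_nonneg _) (Real.sqrt_nonneg _))
  rw [mul_pow, O.sq_normV, O.normB_eq]
  exact CoerciveOperator.sq_inner_le_mul_sq_sumNorm hS
    (fun w hw => (hasWeakDiv_weakDiv u).inner_eq hw) q

end WeightOperators

/-! ### The conditions for the mixed problem -/

variable {α : ℝ}

namespace WeightOperators

variable (O : WeightOperators Ω K)

include O

theorem setting (hd : 0 < d) (hΩ : IsOpen Ω) (hb : Bornology.IsBounded Ω) (h1 : α ≤ 1) :
    (problem Ω (H10Graph Ω) K α).Setting 1 := by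
  obtain ⟨S, hS⟩ := O.exists_solution_operator (H10Submodule Ω) isClosed_closure
  obtain ⟨κ, -, hκ⟩ := exists_norm_fst_le hd hb hΩ.measurableSet
  have hB : normB (H10Graph Ω) K = O.sumNorm (H10Submodule Ω : Set (L2 Ω × L2Vec Ω)) :=
    O.normB_eq _
  have hbil : IsBilinear fun u v : HDiv Ω =>
      weightedInner (fun x => (K x)⁻¹) (u : L2Vec Ω) (v : L2Vec Ω) := by
    simp only [O.weightedInner_inv_eq]
    let B := ((innerₗ (L2Vec Ω)) ∘ₗ O.E).compl₁₂ (HDiv Ω).subtype (HDiv Ω).subtype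
    exact ⟨fun u => (B u).isLinear, fun v => (B.flip v).isLinear⟩
  have hsymm : ∀ u v : HDiv Ω, weightedInner (fun x => (K x)⁻¹) (u : L2Vec Ω) (v : L2Vec Ω) =
      weightedInner (fun x => (K x)⁻¹) (v : L2Vec Ω) (u : L2Vec Ω) := fun u v => by
    rw [O.weightedInner_inv_eq, O.weightedInner_inv_eq, O.inner_E_comm]
  have hnn : ∀ u : HDiv Ω, 0 ≤ weightedInner (fun x => (K x)⁻¹) (u : L2Vec Ω) (u : L2Vec Ω) :=
    fun u => by
      rw [O.weightedInner_inv_eq]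
      exact O.inner_E_nonneg _
  have hle : ∀ u : HDiv Ω, weightedInner (fun x => (K x)⁻¹) (u : L2Vec Ω) (u : L2Vec Ω) ≤
      normV K u ^ 2 := fun u => by
    rw [O.sq_normV, O.weightedInner_inv_eq]
    linarith [sq_nonneg ‖weakDiv u‖]
  exact
    { hilbert_V := O.isHilbertNorm_normV hΩ
      hilbert_b := by
        change IsHilbertNorm (normB (H10Graph Ω) K)
        rw [hB]
        exact CoerciveOperator.isHilbertNorm_sumNorm hS hκ
      hilbert_Q := by
        change IsHilbertNorm fun p : L2 Ω => √(normB (H10Graph Ω) K p ^ 2 + inner ℝ p p)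
        rw [hB]
        exact CoerciveOperator.isHilbertNorm_sqrt_sumNorm_add hS
      bilinear_a := hbil
      bilinear_b := by
        let B := (innerₗ (L2 Ω)) ∘ₗ weakDivₗ hΩ
        exact ⟨fun u => (B u).isLinear, fun q => (B.flip q).isLinear⟩
      bilinear_c :=
        ⟨fun p => (innerₗ (L2 Ω) p).isLinear, fun q => ((innerₗ (L2 Ω)).flip q).isLinear⟩
      continuous_a := fun u v => by
        change |weightedInner _ (u : L2Vec Ω) (v : L2Vec Ω)| ≤ 1 * normV K u * normV K v
        rw [one_mul]
        refine abs_le_of_sq_le_sq ?_ (mul_nonneg (Real.sqrt_nonneg _) (Real.sqrt_nonneg _))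
        rw [mul_pow]
        refine le_trans ?_ (mul_le_mul (hle u) (hle v) (hnn v) (sq_nonneg _))
        let B := LinearMap.mk₂ ℝ (fun u v : HDiv Ω =>
          weightedInner (fun x => (K x)⁻¹) (u : L2Vec Ω) (v : L2Vec Ω))
          (fun x y v => (hbil.2 v).map_add x y) (fun k x v => (hbil.2 v).map_smul k x)
          (fun x v w => (hbil.1 x).map_add v w) (fun k x v => (hbil.1 x).map_smul k v)
        exact LinearMap.BilinForm.apply_sq_le_of_symm B hnn ⟨hsymm⟩ u v
      continuous_b := fun u q => by
        change |inner ℝ (weakDiv u) q| ≤ 1 * normV K u * normB (H10Graph Ω) K q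
        rw [one_mul]
        exact O.abs_inner_weakDiv_le hS u q
      symm_a := hsymm
      nonneg_a := hnn
      symm_c := fun p q => real_inner_comm q p
      nonneg_c := fun q => real_inner_self_nonneg
      t_nonneg := Real.sqrt_nonneg α
      t_le_one := Real.sqrt_le_one.2 h1 }

/-- The data of the abstract theory for the mixed problem: the map `W` of the inf-sup condition
and the equivalence of `‖·‖_b` with the norm of `L²(Ω)`, which holds with a constant that depends
on `K`. -/
theorem exists_data (hd : 0 < d) (hΩ : IsOpen Ω) (hb : Bornology.IsBounded Ω) :
    ∃ (W : L2 Ω →ₗ[ℝ] HDiv Ω) (k : ℝ), 0 < k ∧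
      (∀ p, normV K (W p) ≤ normB (H10Graph Ω) K p) ∧
      (∀ p, inner ℝ (weakDiv (W p)) p = normB (H10Graph Ω) K p ^ 2) ∧
      (∀ p : L2 Ω, inner ℝ p p ≤ k * normB (H10Graph Ω) K p ^ 2) ∧
      ∀ p : L2 Ω, normB (H10Graph Ω) K p ^ 2 ≤ inner ℝ p p := by
  obtain ⟨S, hS⟩ := O.exists_solution_operator (H10Submodule Ω) isClosed_closure
  obtain ⟨κ, -, hκ⟩ := exists_norm_fst_le hd hb hΩ.measurableSet
  obtain ⟨W, hWn, hWb⟩ := O.exists_lifting hΩ hS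
  obtain ⟨k, hk, hle⟩ := CoerciveOperator.exists_norm_sq_le_sumNorm hS hκ
  refine ⟨W, k, hk, hWn, hWb, fun p => ?_, fun p => ?_⟩
  · rw [real_inner_self_eq_norm_sq, O.normB_eq]
    exact hle p
  · rw [real_inner_self_eq_norm_sq, O.normB_eq]
    exact pow_le_pow_left₀ (O.sumNorm_nonneg _ p) (CoerciveOperator.sumNorm_le_norm hS p) 2

/-- The Brezzi and Braess conditions and stability, from the data of `exists_data` and the weak
divergence, which represents `b` by `c`. -/
theorem conditions (hd : 0 < d) (hΩ : IsOpen Ω) (hb : Bornology.IsBounded Ω) (h1 : α ≤ 1) :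
    (problem Ω (H10Graph Ω) K α).Brezzi (1 / 2) ∧ (problem Ω (H10Graph Ω) K α).Braess (1 / 2) ∧
      (problem Ω (H10Graph Ω) K α).Stable 6 := by
  obtain ⟨W, k, -, hWn, hWb, hck, hbc⟩ := O.exists_data hd hΩ hb
  have hP := O.setting hd hΩ hb h1
  have hD : ∀ u : HDiv Ω, normV K u ^ 2 =
      weightedInner (fun x => (K x)⁻¹) (u : L2Vec Ω) (u : L2Vec Ω) +
        inner ℝ (weakDiv u) (weakDiv u) := fun u => by
    rw [O.sq_normV, O.weightedInner_inv_eq, real_inner_self_eq_norm_sq]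
  exact ⟨hP.brezzi hWn hWb hD fun u q => rfl, hP.braess hD (fun u q => rfl) hbc,
    hP.stable hck W (weakDivₗ hΩ) hWn hWb hD (fun u q => rfl) hbc⟩

/-- The functional `q ↦ (f, q)` is bounded in the energy norm, so that stability applies to it. -/
theorem existsUnique_solves (hd : 0 < d) (hΩ : IsOpen Ω) (hb : Bornology.IsBounded Ω)
    (h1 : α ≤ 1) (f : L2 Ω) : ∃! x : HDiv Ω × L2 Ω,
      (problem Ω (H10Graph Ω) K α).Solves (fun _ => 0) (fun q => inner ℝ f q) x := by
  obtain ⟨W, k, hk, -, -, hck, -⟩ := O.exists_data hd hΩ hb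
  have hP := O.setting hd hΩ hb h1
  obtain ⟨-, -, hst⟩ := O.conditions hd hΩ hb h1
  obtain ⟨x, hx, huniq, -⟩ := hst 0 (innerₗ (L2 Ω) f) (‖f‖ * √k) (by positivity) fun v q => by
    have h2 : ‖q‖ ≤ √k * normB (H10Graph Ω) K q := by
      refine abs_le_of_sq_le_sq' ?_ (mul_nonneg (Real.sqrt_nonneg _) (Real.sqrt_nonneg _)) |>.2
      rw [mul_pow, Real.sq_sqrt hk.le, ← real_inner_self_eq_norm_sq]
      exact hck q
    have h3 : normB (H10Graph Ω) K q ≤ (problem Ω (H10Graph Ω) K α).energy v q :=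
      SaddlePoint.normB_le_energy _ hP.nonneg_c v q
    rw [LinearMap.zero_apply, zero_add, mul_assoc]
    refine (abs_real_inner_le_norm f q).trans (mul_le_mul_of_nonneg_left ?_ (norm_nonneg f))
    exact h2.trans (mul_le_mul_of_nonneg_left h3 (Real.sqrt_nonneg k))
  exact ⟨x, hx, huniq⟩

/-- Replacing `H¹₀(Ω)` by `H¹(Ω)` decreases `‖·‖_b`. -/
theorem normB_H1Graph_le (p : L2 Ω) : normB (H1Graph Ω) K p ≤ normB (H10Graph Ω) K p := by
  rw [O.normB_eq, O.normB_eq]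
  exact O.sumNorm_anti ⟨0, (H10Submodule Ω).zero_mem⟩ H10Graph_subset_H1Graph p

end WeightOperators

end MixedPoisson

end

theorem mainTheorem2 :
    ∃ β C : ℝ, 0 < β ∧ 0 < C ∧
      ∀ (d : ℕ) (Ω : Set (EuclideanSpace ℝ (Fin d)))
        (K : EuclideanSpace ℝ (Fin d) → Matrix (Fin d) (Fin d) ℝ) (α : ℝ),
        0 < d → IsOpen Ω → Bornology.IsBounded Ω → MixedPoisson.IsCoefficient Ω K →
        0 ≤ α → α ≤ 1 →
          ((MixedPoisson.problem Ω (MixedPoisson.H10Graph Ω) K α).Setting C ∧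
            (MixedPoisson.problem Ω (MixedPoisson.H10Graph Ω) K α).Brezzi β ∧
            (MixedPoisson.problem Ω (MixedPoisson.H10Graph Ω) K α).Braess β ∧
            (MixedPoisson.problem Ω (MixedPoisson.H10Graph Ω) K α).Stable C ∧
            ∀ f : MixedPoisson.L2 Ω, ∃! x : MixedPoisson.HDiv Ω × MixedPoisson.L2 Ω,
              (MixedPoisson.problem Ω (MixedPoisson.H10Graph Ω) K α).Solves
                (fun _ => 0) (fun q => inner ℝ f q) x) ∧
          ((MixedPoisson.problem Ω (MixedPoisson.H1Graph Ω) K α).Brezzi β ∧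
            (MixedPoisson.problem Ω (MixedPoisson.H1Graph Ω) K α).Braess β ∧
            (MixedPoisson.problem Ω (MixedPoisson.H1Graph Ω) K α).Stable C) := by
  refine ⟨1 / 2, 6, by norm_num, by norm_num, fun d Ω K α hd hΩ hb hK _ h1 => ?_⟩
  obtain ⟨O⟩ := hK.nonempty_weightOperators hΩ.measurableSet
  obtain ⟨hBr, hBs, hSt⟩ := O.conditions hd hΩ hb h1
  have h0 : ∀ q, 0 ≤ MixedPoisson.normB (MixedPoisson.H1Graph Ω) K q :=
    fun q => Real.sqrt_nonneg _
  exact ⟨⟨(O.setting hd hΩ hb h1).mono (by norm_num), hBr, hBs, hSt,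
    O.existsUnique_solves hd hΩ hb h1⟩, hBr.mono (by norm_num) O.normB_H1Graph_le,
    hBs.mono h0 O.normB_H1Graph_le, hSt.mono h0 O.normB_H1Graph_le⟩
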